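/- Let $B_0>0$, $0\le\gamma\le1$, let $\Omega\subset\mathbb R^3$ be open, bounded and convex, and let $0\le\alpha<1/2$. Put $M(\zeta)=\pi^{-3/2}e^{-|\zeta|^2}$ and $B(r,\theta)=B_0r^\gamma\sin\theta\cos\theta$, and let $L=-\nu+K$ be the linearization at $M$ of the Boltzmann collision operator with cross section $B(|\zeta-\zeta_*|,\theta)$, that is, $Lh=M^{-1/2}\big(Q(M,M^{1/2}h)+Q(M^{1/2}h,M)\big)$. Explicitly, $$\nu(\zeta)=\int_{\mathbb R^3}\int_0^{2\pi}\int_0^{\pi/2}B(|\zeta-\zeta_*|,\theta)M(\zeta_*)\,d\theta\,d\phi\,d\zeta_*,\qquad Kh(x,\zeta)=\int_{\mathbb R^3}k(\zeta,\zeta_*)h(x,\zeta_*)\,d\zeta_*,$$ where, with $w=\zeta_*-\zeta$ and $w^\perp$ the plane through $0$ orthogonal to $w$, $$k(\zeta,\zeta_*)=\frac{2B_0}{|w|}\int_{w^\perp}(|w|^2+|v|^2)^{\frac{\gamma-1}2}M(\zeta+v)^{\frac12}M(\zeta_*+v)^{\frac12}\,dv-\Big(\int_0^{2\pi}\int_0^{\pi/2}B(|w|,\theta)\,d\theta\,d\phi\Big)M(\zeta)^{\frac12}M(\zeta_*)^{\frac12}.$$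 For $x\in\overline\Omega$ and $\zeta\in\mathbb R^3$ let $\tau_-(x,\zeta)=\inf\{s>0: x-s\zeta\notin\Omega\}$ and $$S_\Omega h(x,\zeta)=\int_0^{\tau_-(x,\zeta)}e^{-\nu(\zeta)s}h(x-s\zeta,\zeta)\,ds.$$ Let $L^\infty_\alpha(\Omega\times\mathbb R^3)$ be the space of measurable functions $f$ on $\Omega\times\mathbb R^3$ for which $\|f\|_{L^\infty_\alpha}$, the essential supremum of $|f(x,\zeta)|e^{\alpha|\zeta|^2}$ over $\Omega\times\mathbb R^3$, is finite. Then there is a constant $C>0$, depending only on $\Omega,\alpha,\gamma,B_0$, such that for every $f\in L^\infty_\alpha(\Omega\times\mathbb R^3)$ the integrals defining $G=KS_\Omega Kf$ converge absolutely (the one for $Kf(z,\zeta)$ for almost every $z\in\Omega$ and all $\zeta$; the one for $S_\Omega Kf(x,\zeta_*)$ for every $x\in\overline\Omega$ and almost every $\zeta_*$; the outer one for every $x\in\overline\Omega$ and $\zeta\in\mathbb R^3$), and $$|G(x,\zeta)-G(y,\zeta)|\le C\,\|f\|_{L^\infty_\alpha}\,|x-y|\,\big(1+|\log|x-y||\big)\,e^{-\alpha|\zeta|^2}$$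 for all $x,y\in\overline\Omega$ and $\zeta\in\mathbb R^3$ (the right-hand side is read as $0$ when $x=y$). -/

import Mathlib

open Real Set MeasureTheory

namespace LinBoltzmann

noncomputable section

/-- Position space and velocity space. -/
abbrev R3 := EuclideanSpace ℝ (Fin 3)

/-- The global Maxwellian `M(ζ) = π^{-3/2} e^{-|ζ|²}`. -/
def maxwellian (ζ : R3) : ℝ := π ^ (-(3 / 2) : ℝ) * exp (-‖ζ‖ ^ 2)

/-- The collision cross section `B(r, θ) = B₀ r^γ sin θ cos θ`. -/
def crossSection (B₀ γ r θ : ℝ) : ℝ := B₀ * r ^ γ * sin θ * cos θ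

/-- The angular integral `∫₀^{2π} ∫₀^{π/2} B(r, θ) dθ dφ` of the cross section. -/
def angularCrossSection (B₀ γ r : ℝ) : ℝ :=
  ∫ _φ in (0 : ℝ)..(2 * π), ∫ θ in (0 : ℝ)..(π / 2), crossSection B₀ γ r θ

/-- The collision frequency
`ν(ζ) = ∫_{ℝ³} ∫₀^{2π} ∫₀^{π/2} B(|ζ - ζ_*|, θ) M(ζ_*) dθ dφ dζ_*` (it depends on `|ζ|` only). -/
def nu (B₀ γ : ℝ) (ζ : R3) : ℝ :=
  ∫ ζs : R3, angularCrossSection B₀ γ ‖ζ - ζs‖ * maxwellian ζs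

/-- The loss part of the kernel of `K`, coming from the term `-F(ζ) G(ζ_*)` of the collision
operator in which the perturbation is evaluated at `ζ_*`:
`∫₀^{2π} ∫₀^{π/2} B(|ζ - ζ_*|, θ) dθ dφ · M(ζ)^{1/2} M(ζ_*)^{1/2}`. -/
def kLoss (B₀ γ : ℝ) (ζ ζs : R3) : ℝ :=
  angularCrossSection B₀ γ ‖ζ - ζs‖ * (√(maxwellian ζ) * √(maxwellian ζs))

/-- The length of the component of `ζ` orthogonal to `w`. -/
def perpLength (ζ w : R3) : ℝ := ‖ζ - (inner ℝ ζ w / ‖w‖ ^ 2) • w‖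

/-- The gain part of the kernel of `K`, coming from the term `F(ζ') G(ζ_*')`.
Writing a collision partner of `ζ` as `ζ + w + v` with `w = (V · ω) ω`, `v ⊥ ω` (`V` the relative
velocity, so that `|V|² = |w|² + |v|²`), the post-collisional velocities are `ζ + w` and `ζ + v`;
for this cross section they contribute equally, `B dθ dφ dV = B₀ |V|^{γ-1} |w|⁻¹ dv dw`,
and the kernel at `ζ_* = ζ + w` is
`2 B₀ |w|⁻¹ ∫_{v ⊥ w} |V|^{γ-1} M(ζ + v)^{1/2} M(ζ + v + w)^{1/2} dv`.
If `ζ_⊥` is the component of `ζ` orthogonal to `w`, then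
`(|ζ + v|² + |ζ + v + w|²) / 2 = |ζ_⊥ + v|² + (|w|² + ((|ζ|² - |ζ_*|²) / |w|)²) / 4`,
and the plane orthogonal to `w` is identified with `ℝ²` so that `ζ_⊥` becomes `(|ζ_⊥|, 0)`. -/
def kGain (B₀ γ : ℝ) (ζ ζs : R3) : ℝ :=
  2 * B₀ * π ^ (-(3 / 2) : ℝ) * ‖ζs - ζ‖⁻¹ *
    exp (-(1 / 4) * (‖ζ - ζs‖ ^ 2 + ((‖ζ‖ ^ 2 - ‖ζs‖ ^ 2) / ‖ζ - ζs‖) ^ 2)) *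
    ∫ v : EuclideanSpace ℝ (Fin 2),
      (‖ζs - ζ‖ ^ 2 + ‖v‖ ^ 2) ^ ((γ - 1) / 2) * exp (-‖!₂[perpLength ζ (ζs - ζ), 0] + v‖ ^ 2)

/-- The kernel `k(ζ, ζ_*)` of the integral part `K` of the linearized collision operator
`L h = M^{-1/2} (Q(M, M^{1/2} h) + Q(M^{1/2} h, M)) = -ν h + K h`. -/
def kernelK (B₀ γ : ℝ) (ζ ζs : R3) : ℝ := kGain B₀ γ ζ ζs - kLoss B₀ γ ζ ζs

/-- `K h(x, ζ) = ∫_{ℝ³} k(ζ, ζ_*) h(x, ζ_*) dζ_*`. -/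
def opK (B₀ γ : ℝ) (h : R3 → R3 → ℝ) (x ζ : R3) : ℝ :=
  ∫ ζs : R3, kernelK B₀ γ ζ ζs * h x ζs

/-- The backward exit time `τ₋(x, ζ) = inf {s > 0 | x - s ζ ∉ Ω}`. -/
def tauMinus (Ω : Set R3) (x ζ : R3) : ℝ := sInf {s : ℝ | 0 < s ∧ x - s • ζ ∉ Ω}

/-- `S_Ω h(x, ζ) = ∫₀^{τ₋(x, ζ)} e^{-ν(ζ) s} h(x - s ζ, ζ) ds`. -/
def opS (B₀ γ : ℝ) (Ω : Set R3) (h : R3 → R3 → ℝ) (x ζ : R3) : ℝ :=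
  ∫ s in (0 : ℝ)..tauMinus Ω x ζ, exp (-nu B₀ γ ζ * s) * h (x - s • ζ) ζ

/-- `G = K S_Ω K f`. -/
def opG (B₀ γ : ℝ) (Ω : Set R3) (f : R3 → R3 → ℝ) : R3 → R3 → ℝ :=
  opK B₀ γ (opS B₀ γ Ω (opK B₀ γ f))

/-- The weighted function `f(x, ζ) e^{α |ζ|²}`. -/
def weighted (α : ℝ) (f : R3 → R3 → ℝ) (p : R3 × R3) : ℝ := f p.1 p.2 * exp (α * ‖p.2‖ ^ 2)

/-- `f ∈ L^∞_α(Ω × ℝ³)`. -/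
def MemLinfty (α : ℝ) (Ω : Set R3) (f : R3 → R3 → ℝ) : Prop :=
  MemLp (weighted α f) ⊤ (volume.restrict (Ω ×ˢ (univ : Set R3)))

/-- The norm of `L^∞_α(Ω × ℝ³)`: the (essential) supremum of `|f(x, ζ)| e^{α |ζ|²}`. -/
def normLinfty (α : ℝ) (Ω : Set R3) (f : R3 → R3 → ℝ) : ℝ :=
  (eLpNorm (weighted α f) ⊤ (volume.restrict (Ω ×ˢ (univ : Set R3)))).toReal

end

end LinBoltzmann

/-! Extend `f` by zero outside `Ω`. A backward ray from a point of the closure of a convex set never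
re-enters after its exit, so `S_Ω` becomes transport along the whole ray and `G(x, ζ) = ∫₀^∞ ds ∫∫
k(ζ,q) k(q,η) e^{-ν(q)s} f(x - s q, η) dη dq`. No regularity of `f` in `x` is available. For a fixed
travel time `s`, however, moving `x` to `y` is the same as translating the intermediate velocity `q`
by `a = (x - y)/s`, since `x - s(q + a) = y - s q`. The difference thus falls on the kernel `k(ζ,q)
k(q,η) e^{-ν(q)s}`, and it is enough that this kernel is Lipschitz under translations in `q`, in
`L¹` with weight `e^{-α|η|²}`. The slice at time `s` then changes by at most a constant times
`min(1, |x - y|/s) e^{-κs}`, whose integral over `s` is of order `|x - y|(1 + |log|x - y||)`.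

The `L¹` Lipschitz bound (`exists_lintegral_doubleKernel_le`) rests on two facts. The kernel
`k(ζ,q)` and its gradient in `q` are controlled by `(1 + |ζ|)` times `kernelWeight`, whose
singularity `|q - ζ|⁻²` is integrable in dimension three (`exists_kernelK_bounds`). The factor `1 +
|ζ|` is then paid back by the Gaussian in `(|ζ|² - |q|²)/|q - ζ|`, which confines `q - ζ` to
directions almost orthogonal to `ζ` (`exists_lintegral_exp_div_le`,
`exists_lintegral_kernelWeight_le`). The condition `α < 1/2` leaves room for an exponent `β` with
`α/2 < β < 1/4`: the lower bound keeps the weight `e^{-α|ζ|²}` stable, the upper one absorbs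
polynomial factors. -/

namespace LinBoltzmann

open Filter Topology

/-! ### Pointwise Lipschitz constants and their integration along segments. -/

/-- The pointwise Lipschitz constant of `g` at `p` is at most `c`. -/
def SlopeLE {E : Type*} [PseudoMetricSpace E] (g : E → ℝ) (p : E) (c : ℝ) : Prop :=
  ∀ c' > c, ∀ᶠ q in 𝓝 p, |g q - g p| ≤ c' * dist q p

namespace SlopeLE

variable {E : Type*} [PseudoMetricSpace E] {g h : E → ℝ} {p : E} {c d : ℝ}

theorem mono (hg : SlopeLE g p c) (hcd : c ≤ d) : SlopeLE g p d :=
  fun c' hc' => hg c' (lt_of_le_of_lt hcd hc')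

theorem of_bound {A : E → ℝ} (hA : ContinuousAt A p) (hc : A p ≤ c)
    (hg : ∀ᶠ q in 𝓝 p, |g q - g p| ≤ A q * dist q p) : SlopeLE g p c := by
  intro c' hc'
  filter_upwards [hg, hA.eventually (gt_mem_nhds (lt_of_le_of_lt hc hc'))] with q h1 h2
  exact h1.trans (mul_le_mul_of_nonneg_right h2.le dist_nonneg)

theorem continuousAt (hg : SlopeLE g p c) : ContinuousAt g p := by
  rw [ContinuousAt, tendsto_iff_dist_tendsto_zero]
  have h1 : Tendsto (fun q => (c + 1) * dist q p) (𝓝 p) (𝓝 0) := by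
    have : Continuous (fun q => (c + 1) * dist q p) := by fun_prop
    simpa using this.tendsto p
  refine squeeze_zero' (Eventually.of_forall fun _ => dist_nonneg) ?_ h1
  filter_upwards [hg (c + 1) (by linarith)] with q hq
  rwa [Real.dist_eq]

theorem mul (hg : SlopeLE g p c) (hh : SlopeLE h p d) :
    SlopeLE (fun q => g q * h q) p (c * |h p| + |g p| * d) := by
  intro e he
  have hlim : Tendsto (fun ε : ℝ => (c + ε) * |h p| + |g p| * (d + ε)) (𝓝[>] 0)
      (𝓝 (c * |h p| + |g p| * d)) := by
    have : Continuous (fun ε : ℝ => (c + ε) * |h p| + |g p| * (d + ε)) := by fun_prop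
    simpa using (this.tendsto 0).mono_left nhdsWithin_le_nhds
  obtain ⟨ε, hε, hε0⟩ := ((hlim.eventually (gt_mem_nhds he)).and self_mem_nhdsWithin).exists
  have hε0 : 0 < ε := hε0
  have hcont : ContinuousAt (fun q => (c + ε) * |h q| + |g p| * (d + ε)) p := by
    have := hh.continuousAt
    fun_prop
  filter_upwards [hcont.eventually (gt_mem_nhds hε), hg (c + ε) (by linarith),
    hh (d + ε) (by linarith)] with q h1 h2 h3
  calc |g q * h q - g p * h p| = |(g q - g p) * h q + g p * (h q - h p)| := by ring_nf
    _ ≤ |g q - g p| * |h q| + |g p| * |h q - h p| := by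
      rw [← abs_mul, ← abs_mul]; exact abs_add_le _ _
    _ ≤ ((c + ε) * dist q p) * |h q| + |g p| * ((d + ε) * dist q p) := by gcongr
    _ = ((c + ε) * |h q| + |g p| * (d + ε)) * dist q p := by ring
    _ ≤ e * dist q p := mul_le_mul_of_nonneg_right h1.le dist_nonneg

theorem const (x : ℝ) (p : E) : SlopeLE (fun _ => x) p 0 := by
  intro c' hc'
  filter_upwards with q
  simpa using mul_nonneg (le_of_lt hc') dist_nonneg

theorem const_mul (hg : SlopeLE g p c) (x : ℝ) : SlopeLE (fun q => x * g q) p (|x| * c) := by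
  simpa using (const x p).mul hg

theorem sub (hg : SlopeLE g p c) (hh : SlopeLE h p d) :
    SlopeLE (fun q => g q - h q) p (c + d) := by
  intro e he
  filter_upwards [hg (c + (e - (c + d)) / 2) (by linarith),
    hh (d + (e - (c + d)) / 2) (by linarith)] with q h1 h2
  calc |g q - h q - (g p - h p)| = |(g q - g p) - (h q - h p)| := by ring_nf
    _ ≤ |g q - g p| + |h q - h p| := abs_sub _ _
    _ ≤ e * dist q p := by linarith

theorem comp {φ : ℝ → ℝ} {a : ℝ} (hφ : SlopeLE φ (g p) a) (ha : 0 ≤ a) (hg : SlopeLE g p c) :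
    SlopeLE (fun q => φ (g q)) p (a * c) := by
  intro e he
  have hlim : Tendsto (fun ε : ℝ => (a + ε) * (c + ε)) (𝓝[>] 0) (𝓝 (a * c)) := by
    have : Continuous (fun ε : ℝ => (a + ε) * (c + ε)) := by fun_prop
    simpa using (this.tendsto 0).mono_left nhdsWithin_le_nhds
  obtain ⟨ε, hε, hε0⟩ := ((hlim.eventually (gt_mem_nhds he)).and self_mem_nhdsWithin).exists
  have hε0 : 0 < ε := hε0
  filter_upwards [hg.continuousAt.eventually (hφ (a + ε) (by linarith)),
    hg (c + ε) (by linarith)] with q h1 h2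
  rw [Real.dist_eq] at h1
  calc _ ≤ (a + ε) * |g q - g p| := h1
    _ ≤ (a + ε) * ((c + ε) * dist q p) := by gcongr
    _ = ((a + ε) * (c + ε)) * dist q p := by ring
    _ ≤ e * dist q p := mul_le_mul_of_nonneg_right hε.le dist_nonneg

theorem of_hasDerivAt {φ : ℝ → ℝ} {φ' x : ℝ} (h : HasDerivAt φ φ' x) : SlopeLE φ x |φ'| := by
  intro c' hc'
  have := (hasDerivAt_iff_isLittleO.1 h).def (sub_pos.2 hc')
  filter_upwards [this] with y hy
  rw [Real.dist_eq]
  simp only [Real.norm_eq_abs, smul_eq_mul] at hy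
  calc |φ y - φ x| = |(φ y - φ x - (y - x) * φ') + (y - x) * φ'| := by ring_nf
    _ ≤ |φ y - φ x - (y - x) * φ'| + |y - x| * |φ'| := by
      rw [← abs_mul]; exact abs_add_le _ _
    _ ≤ c' * |y - x| := by linarith

theorem comp_hasDerivAt {φ : ℝ → ℝ} {φ' : ℝ} (hφ : HasDerivAt φ φ' (g p)) (hg : SlopeLE g p c) :
    SlopeLE (fun q => φ (g q)) p (|φ'| * c) :=
  (of_hasDerivAt hφ).comp (abs_nonneg _) hg

theorem comp_sub_const {E : Type*} [SeminormedAddCommGroup E] {g : E → ℝ} {p z : E} {c : ℝ}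
    (hg : SlopeLE g (p - z) c) : SlopeLE (fun q => g (q - z)) p c := by
  intro c' hc'
  have h1 : Tendsto (fun q : E => q - z) (𝓝 p) (𝓝 (p - z)) := by
    have : Continuous (fun q : E => q - z) := by fun_prop
    exact this.tendsto p
  filter_upwards [h1.eventually (hg c' hc')] with q hq
  simpa using hq

theorem comp_line {E : Type*} [NormedAddCommGroup E] [NormedSpace ℝ E] {g : E → ℝ} {p a : E}
    {t c : ℝ} (hg : SlopeLE g (p + t • a) c) :
    SlopeLE (fun s : ℝ => g (p + s • a)) t (‖a‖ * c) := by
  intro c' hc'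
  have h1 : Tendsto (fun s : ℝ => p + s • a) (𝓝 t) (𝓝 (p + t • a)) := by
    have : Continuous (fun s : ℝ => p + s • a) := by fun_prop
    exact this.tendsto t
  have hlim : Tendsto (fun ε : ℝ => ‖a‖ * (c + ε)) (𝓝[>] 0) (𝓝 (‖a‖ * c)) := by
    have : Continuous (fun ε : ℝ => ‖a‖ * (c + ε)) := by fun_prop
    simpa using (this.tendsto 0).mono_left nhdsWithin_le_nhds
  obtain ⟨ε, hε, hε0⟩ := ((hlim.eventually (gt_mem_nhds hc')).and self_mem_nhdsWithin).exists
  have hε0 : 0 < ε := hε0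
  filter_upwards [h1.eventually (hg (c + ε) (by linarith))] with s hs
  rw [dist_add_left, dist_eq_norm, ← sub_smul, norm_smul] at hs
  calc _ ≤ _ := hs
    _ = (‖a‖ * (c + ε)) * dist s t := by rw [Real.dist_eq, Real.norm_eq_abs]; ring
    _ ≤ _ := mul_le_mul_of_nonneg_right hε.le dist_nonneg

/-- A substitute for the fundamental theorem of calculus without differentiability: `|φ t - φ 0|` is
compared with the primitive of `D` through its right lower slopes. This suits the kernel, since
`perpLength` is not smooth where it vanishes. -/
theorem abs_sub_le_integral {φ D : ℝ → ℝ} (hφ : ∀ t ∈ Icc (0 : ℝ) 1, SlopeLE φ t (D t))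
    (hD : ContinuousOn D (Icc 0 1)) : |φ 1 - φ 0| ≤ ∫ t in (0 : ℝ)..1, D t := by
  -- Extending `D` by its end values makes it continuous on the line, so its primitive is
  -- differentiable at the end points too.
  set D' : ℝ → ℝ := IccExtend zero_le_one ((Icc (0 : ℝ) 1).domRestrict D) with hD'
  have hc : Continuous D' := (continuousOn_iff_continuous_domRestrict.1 hD).Icc_extend'
  have heq : ∀ t ∈ Icc (0 : ℝ) 1, D' t = D t := fun t ht => by
    rw [hD', IccExtend_of_mem _ _ ht]; rfl
  have hint : ∫ t in (0 : ℝ)..1, D t = ∫ t in (0 : ℝ)..1, D' t := by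
    refine intervalIntegral.integral_congr fun t ht => (heq t ?_).symm
    rwa [uIcc_of_le zero_le_one] at ht
  rw [hint]
  have hφc : ContinuousOn φ (Icc 0 1) := fun t ht => (hφ t ht).continuousAt.continuousWithinAt
  have hB : ∀ x : ℝ, HasDerivAt (fun t => ∫ s in (0 : ℝ)..t, D' s) (D' x) x := fun x =>
    (hc.integral_hasStrictDerivAt 0 x).hasDerivAt
  refine image_le_of_liminf_slope_right_le_deriv_boundary (f := fun t => |φ t - φ 0|)
    (B := fun t => ∫ s in (0 : ℝ)..t, D' s) (B' := D') (a := 0) (b := 1) ?_ ?_ ?_ ?_ ?_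
    (right_mem_Icc.2 zero_le_one)
  · exact (hφc.sub continuousOn_const).abs
  · simp
  · exact fun x _ => (hB x).continuousAt.continuousWithinAt
  · exact fun x _ => (hB x).hasDerivWithinAt
  · intro x hx r hr
    rw [heq x ⟨hx.1, hx.2.le⟩] at hr
    obtain ⟨r', hr1, hr2⟩ := exists_between hr
    refine Eventually.frequently ?_
    filter_upwards [(hφ x ⟨hx.1, hx.2.le⟩ r' hr1).filter_mono nhdsWithin_le_nhds,
      self_mem_nhdsWithin] with z hz hxz
    have hxz : x < z := hxz
    rw [slope_def_field, div_lt_iff₀ (sub_pos.2 hxz)]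
    rw [Real.dist_eq, abs_of_pos (sub_pos.2 hxz)] at hz
    have h1 : |φ z - φ 0| - |φ x - φ 0| ≤ |φ z - φ x| := by
      have := abs_sub_abs_le_abs_sub (φ z - φ 0) (φ x - φ 0)
      simpa using this
    have h2 : r' * (z - x) < r * (z - x) := by
      have := sub_pos.2 hxz
      gcongr
    linarith

end SlopeLE

/-- A function whose pointwise Lipschitz constant along a segment is at most `D` varies along the
segment by at most the integral of `D`. -/
theorem abs_sub_le_norm_mul_integral {E : Type*} [NormedAddCommGroup E] [NormedSpace ℝ E]
    {g D : E → ℝ} {p a : E}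
    (hg : ∀ t ∈ Icc (0 : ℝ) 1, SlopeLE g (p + t • a) (D (p + t • a)))
    (hD : ∀ t ∈ Icc (0 : ℝ) 1, ContinuousAt D (p + t • a)) :
    |g (p + a) - g p| ≤ ‖a‖ * ∫ t in (0 : ℝ)..1, D (p + t • a) := by
  have h := SlopeLE.abs_sub_le_integral (φ := fun s : ℝ => g (p + s • a))
    (D := fun t => ‖a‖ * D (p + t • a)) (fun t ht => (hg t ht).comp_line) ?_
  · simpa using h
  · intro t ht
    have h1 : ContinuousAt (fun s : ℝ => p + s • a) t := by fun_prop
    have h2 : ContinuousAt (fun s : ℝ => D (p + s • a)) t :=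
      ContinuousAt.comp (f := fun s : ℝ => p + s • a) (hD t ht) h1
    exact (continuousAt_const.mul h2).continuousWithinAt

/-! ### Gaussian integrals with an inverse-norm singularity and the directional gain. -/

theorem exists_one_add_pow_mul_exp_le (n : ℕ) {δ : ℝ} (hδ : 0 < δ) :
    ∃ C : ℝ, 0 < C ∧ ∀ u : ℝ, 0 ≤ u → (1 + u) ^ n * exp (-δ * u ^ 2) ≤ C := by
  refine ⟨n.factorial * exp (1 + 1 / (4 * δ)), by positivity, fun u hu => ?_⟩
  have h1 : (1 + u) ^ n ≤ n.factorial * exp (1 + u) := by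
    have := Real.pow_div_factorial_le_exp (1 + u) (by positivity) n
    rw [div_le_iff₀ (by positivity)] at this
    linarith
  calc (1 + u) ^ n * exp (-δ * u ^ 2) ≤ (n.factorial * exp (1 + u)) * exp (-δ * u ^ 2) := by gcongr
    _ = n.factorial * exp (1 + u + -δ * u ^ 2) := by rw [mul_assoc, ← exp_add]
    _ ≤ n.factorial * exp (1 + 1 / (4 * δ)) := by
      refine mul_le_mul_of_nonneg_left (exp_le_exp.2 ?_) (by positivity)
      have : 0 ≤ δ * (u - 1 / (2 * δ)) ^ 2 := by positivity
      have h2 : δ * (u - 1 / (2 * δ)) ^ 2 = δ * u ^ 2 - u + 1 / (4 * δ) := by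
        field_simp; ring
      linarith

section Radial

variable {E : Type*} [NormedAddCommGroup E] [NormedSpace ℝ E] [FiniteDimensional ℝ E]
  [MeasurableSpace E] [BorelSpace E] (μ : Measure E) [μ.IsAddHaarMeasure]

theorem integrable_exp_neg_mul_norm_sq [Nontrivial E] {c : ℝ} (hc : 0 < c) :
    Integrable (fun x : E => exp (-c * ‖x‖ ^ 2)) μ := by
  rw [integrable_fun_norm_addHaar (f := fun y => exp (-c * y ^ 2)) μ]
  have := integrableOn_rpow_mul_exp_neg_mul_sq hc (s := ((Module.finrank ℝ E - 1 : ℕ) : ℝ))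
    (lt_of_lt_of_le (by norm_num) (Nat.cast_nonneg _))
  simpa only [rpow_natCast, smul_eq_mul] using this

theorem integrable_inv_norm_mul_exp (hE : 2 ≤ Module.finrank ℝ E) {c : ℝ} (hc : 0 < c) :
    Integrable (fun x : E => ‖x‖⁻¹ * exp (-c * ‖x‖ ^ 2)) μ := by
  have : Nontrivial E := Module.nontrivial_of_finrank_pos (R := ℝ) (by omega)
  rw [integrable_fun_norm_addHaar (f := fun y => y⁻¹ * exp (-c * y ^ 2)) μ]
  have := integrableOn_rpow_mul_exp_neg_mul_sq hc (s := ((Module.finrank ℝ E - 2 : ℕ) : ℝ))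
    (lt_of_lt_of_le (by norm_num) (Nat.cast_nonneg _))
  refine this.congr_fun (fun y hy => ?_) measurableSet_Ioi
  have hy : 0 < y := hy
  obtain ⟨d, hd⟩ := Nat.exists_eq_add_of_le hE
  have h1 : Module.finrank ℝ E - 2 = d := by omega
  have h2 : Module.finrank ℝ E - 1 = d + 1 := by omega
  simp only [rpow_natCast, smul_eq_mul, h1, h2]
  field_simp
  rw [pow_succ]

/-- What matters is uniformity in the shift `b`. For `‖v‖ ≥ 1` the singular factor is at most one
and the shift is removed by translation; for `‖v‖ ≤ 1` the shifted Gaussian is at most `1 ≤ e^c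
e^{-c‖v‖²}`, a centred one. -/
theorem exists_integral_inv_norm_mul_exp_shift_le (hE : 2 ≤ Module.finrank ℝ E) {c : ℝ}
    (hc : 0 < c) : ∃ C : ℝ, 0 < C ∧ ∀ b : E,
      Integrable (fun v : E => (1 + ‖v‖⁻¹) * exp (-c * ‖b + v‖ ^ 2)) μ ∧
      ∫ v, (1 + ‖v‖⁻¹) * exp (-c * ‖b + v‖ ^ 2) ∂μ ≤ C := by
  have : Nontrivial E := Module.nontrivial_of_finrank_pos (R := ℝ) (by omega)
  have hG := integrable_exp_neg_mul_norm_sq μ hc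
  have hR := integrable_inv_norm_mul_exp μ hE hc
  set I := ∫ v, 2 * exp (-c * ‖v‖ ^ 2) ∂μ + ∫ v, exp c * (‖v‖⁻¹ * exp (-c * ‖v‖ ^ 2)) ∂μ with hI
  have hI0 : 0 ≤ I := by
    rw [hI]
    exact add_nonneg (integral_nonneg fun v => by positivity)
      (integral_nonneg fun v => by positivity)
  refine ⟨I + 1, by linarith, fun b => ?_⟩
  have hGb : Integrable (fun v => 2 * exp (-c * ‖b + v‖ ^ 2)) μ := (hG.comp_add_left b).const_mul 2
  have hle : ∀ v : E, (1 + ‖v‖⁻¹) * exp (-c * ‖b + v‖ ^ 2) ≤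
      2 * exp (-c * ‖b + v‖ ^ 2) + exp c * (‖v‖⁻¹ * exp (-c * ‖v‖ ^ 2)) := by
    intro v
    rcases le_total 1 ‖v‖ with hv | hv
    · have : ‖v‖⁻¹ ≤ 1 := inv_le_one_of_one_le₀ hv
      have h2 : (1 + ‖v‖⁻¹) * exp (-c * ‖b + v‖ ^ 2) ≤ 2 * exp (-c * ‖b + v‖ ^ 2) := by
        gcongr; linarith
      have : 0 ≤ exp c * (‖v‖⁻¹ * exp (-c * ‖v‖ ^ 2)) := by positivity
      linarith
    · have h1 : exp (-c * ‖b + v‖ ^ 2) ≤ 1 := by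
        rw [exp_le_one_iff]; nlinarith [sq_nonneg ‖b + v‖]
      have h2 : 1 ≤ exp c * exp (-c * ‖v‖ ^ 2) := by
        rw [← exp_add, one_le_exp_iff]
        have : ‖v‖ ^ 2 ≤ 1 := pow_le_one₀ (norm_nonneg _) hv
        nlinarith
      have h3 : ‖v‖⁻¹ * exp (-c * ‖b + v‖ ^ 2) ≤ ‖v‖⁻¹ * (exp c * exp (-c * ‖v‖ ^ 2)) := by
        gcongr; exact h1.trans h2
      have : 0 < exp (-c * ‖b + v‖ ^ 2) := exp_pos _
      linarith
  have hint := hGb.add (hR.const_mul (exp c))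
  refine ⟨hint.mono' (by fun_prop) (Eventually.of_forall fun v => ?_), ?_⟩
  · rw [Real.norm_of_nonneg (by positivity)]
    exact hle v
  · calc _ ≤ ∫ v, (2 * exp (-c * ‖b + v‖ ^ 2) + exp c * (‖v‖⁻¹ * exp (-c * ‖v‖ ^ 2))) ∂μ :=
        integral_mono_of_nonneg (Eventually.of_forall fun v => by positivity) hint
          (Eventually.of_forall hle)
      _ = I := by
        rw [integral_add hGb (hR.const_mul (exp c)), hI,
          integral_add_left_eq_self (fun v => 2 * exp (-c * ‖v‖ ^ 2)) b]
      _ ≤ I + 1 := by linarith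

end Radial

theorem lintegral_inv_add_mul_sq {q B : ℝ} (hq : 0 < q) (hB : 0 < B) :
    ∫⁻ t : ℝ, ENNReal.ofReal (q + B * t ^ 2)⁻¹ = ENNReal.ofReal (π * (√q)⁻¹ * (√B)⁻¹) := by
  have hs : 0 < √B / √q := by positivity
  have heq : ∀ t : ℝ, (q + B * t ^ 2)⁻¹ = q⁻¹ * (1 + (√B / √q * t) ^ 2)⁻¹ := by
    intro t
    rw [mul_pow, div_pow, sq_sqrt hq.le, sq_sqrt hB.le]
    field_simp
  have hi : Integrable (fun t : ℝ => q⁻¹ * (1 + (√B / √q * t) ^ 2)⁻¹) :=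
    (integrable_inv_one_add_sq.comp_mul_left' hs.ne').const_mul _
  simp_rw [heq]
  rw [← ofReal_integral_eq_lintegral_ofReal hi (Eventually.of_forall fun t => by positivity),
    integral_const_mul, Measure.integral_comp_mul_left (fun t => (1 + t ^ 2)⁻¹),
    integral_univ_inv_one_add_sq, abs_of_pos (inv_pos.2 hs), smul_eq_mul]
  congr 1
  have : q = √q * √q := (mul_self_sqrt hq.le).symm
  rw [this, sqrt_mul_self (sqrt_nonneg q)]
  field_simp

/-- The velocity average over directions of `exp (-(ζ·w)²)` gains a factor `(1 + ‖ζ‖)⁻¹`. -/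
theorem exists_lintegral_exp_div_le {δ δ' : ℝ} (hδ : 0 < δ) (hδ' : 0 < δ') :
    ∃ C : ℝ, 0 < C ∧ ∀ ζ : R3,
      ∫⁻ w : R3, ENNReal.ofReal
        (exp (-δ * ‖w‖ ^ 2) * (‖w‖ ^ 2 + δ' * (inner ℝ ζ w) ^ 2)⁻¹) ≤
      ENNReal.ofReal (C * (1 + ‖ζ‖)⁻¹) := by
  have hE2 : 2 ≤ Module.finrank ℝ (EuclideanSpace ℝ (Fin 2)) := by simp
  have hR := integrable_inv_norm_mul_exp (volume : Measure (EuclideanSpace ℝ (Fin 2))) hE2 hδ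
  set I := ∫ v : EuclideanSpace ℝ (Fin 2), ‖v‖⁻¹ * exp (-δ * ‖v‖ ^ 2) with hI
  have hI0 : 0 ≤ I := integral_nonneg fun v => by positivity
  obtain ⟨c, hc0, hc⟩ : ∃ c : ℝ, 0 < c ∧ ∀ r : ℝ, 0 ≤ r →
      (√(1 + δ' * r ^ 2))⁻¹ ≤ c * (1 + r)⁻¹ := by
    -- From `(1 + r)² ≤ 2(1 + r²) ≤ 2(1 + δ'⁻¹)(1 + δ' r²)`.
    refine ⟨√(2 * (1 + δ'⁻¹)), by positivity, fun r hr => ?_⟩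
    rw [← div_eq_mul_inv, le_div_iff₀ (by positivity), inv_mul_le_iff₀ (by positivity),
      ← sqrt_mul (by positivity)]
    apply Real.le_sqrt_of_sq_le
    have h1 : (1 + δ' * r ^ 2) * (2 * (1 + δ'⁻¹)) =
      2 + 2 * r ^ 2 + 2 * δ'⁻¹ + 2 * δ' * r ^ 2 := by
      field_simp; ring
    rw [h1]
    have : 0 < δ'⁻¹ := inv_pos.2 hδ'
    have : 0 ≤ δ' * r ^ 2 := by positivity
    nlinarith [sq_nonneg (r - 1)]
  refine ⟨π * c * I + 1, by positivity, fun ζ => ?_⟩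
  -- A reflection carries the first axis to the direction of `ζ`, so that `ζ·w` becomes `‖ζ‖ w₀`.
  obtain ⟨R, hRζ⟩ : ∃ R : R3 ≃ₗᵢ[ℝ] R3, R (EuclideanSpace.single 0 ‖ζ‖) = ζ := by
    refine ⟨_, Submodule.reflection_sub (v := EuclideanSpace.single 0 ‖ζ‖) (w := ζ) ?_⟩
    simp
  have hin : ∀ w : R3, inner ℝ ζ (R w) = ‖ζ‖ * w 0 := by
    intro w
    conv_lhs => rw [← hRζ]
    rw [LinearIsometryEquiv.inner_map_map]
    simp [EuclideanSpace.inner_single_left]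
  set B : ℝ := 1 + δ' * ‖ζ‖ ^ 2 with hB
  have hB0 : 0 < B := by positivity
  -- The Gaussian in `w₀` is discarded: the rational factor alone is integrable in `w₀`, giving `π /
  -- (√B |v|)` with `√B` comparable to `1 + ‖ζ‖`. The remaining `|v|⁻¹` is integrable in the plane
  -- against the Gaussian.
  have hle : ∀ w : R3, exp (-δ * ‖R w‖ ^ 2) * (‖R w‖ ^ 2 + δ' * (inner ℝ ζ (R w)) ^ 2)⁻¹ ≤
      exp (-δ * (w 1 ^ 2 + w 2 ^ 2)) * ((w 1 ^ 2 + w 2 ^ 2) + B * w 0 ^ 2)⁻¹ := by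
    intro w
    rw [hin, LinearIsometryEquiv.norm_map, EuclideanSpace.real_norm_sq_eq, Fin.sum_univ_three]
    have e1 : w 0 ^ 2 + w 1 ^ 2 + w 2 ^ 2 + δ' * (‖ζ‖ * w 0) ^ 2 =
      (w 1 ^ 2 + w 2 ^ 2) + B * w 0 ^ 2 := by rw [hB]; ring
    rw [e1]
    refine mul_le_mul_of_nonneg_right (exp_le_exp.2 ?_) (by positivity)
    nlinarith [mul_nonneg hδ.le (sq_nonneg (w 0))]
  set F : ℝ → (Fin 2 → ℝ) → ENNReal := fun t v => ENNReal.ofReal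
    (exp (-δ * (v 0 ^ 2 + v 1 ^ 2)) * ((v 0 ^ 2 + v 1 ^ 2) + B * t ^ 2)⁻¹) with hF
  have hFm : Measurable (fun p : ℝ × (Fin 2 → ℝ) => F p.1 p.2) := by
    rw [hF]; fun_prop
  calc _ = ∫⁻ w : R3, ENNReal.ofReal
        (exp (-δ * ‖R w‖ ^ 2) * (‖R w‖ ^ 2 + δ' * (inner ℝ ζ (R w)) ^ 2)⁻¹) :=
        (R.measurePreserving.lintegral_comp_emb R.toHomeomorph.measurableEmbedding _).symm
    _ ≤ ∫⁻ w : R3, F (w 0) ![w 1, w 2] := by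
        refine lintegral_mono fun w => ENNReal.ofReal_le_ofReal ?_
        simpa using hle w
    _ = ∫⁻ w : Fin 3 → ℝ, F (w 0) ![w 1, w 2] :=
        (PiLp.volume_preserving_ofLp (Fin 3)).lintegral_comp_emb
          (MeasurableEquiv.toLp 2 (Fin 3 → ℝ)).symm.measurableEmbedding
          (fun w : Fin 3 → ℝ => F (w 0) ![w 1, w 2])
    _ = ∫⁻ p : ℝ × (Fin 2 → ℝ), F p.1 p.2 := by
        rw [← (volume_preserving_piFinSuccAbove (fun _ : Fin 3 => ℝ) 0).lintegral_comp_emb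
          (MeasurableEquiv.measurableEmbedding _)]
        refine lintegral_congr fun w => ?_
        congr 1
        ext i; fin_cases i <;> rfl
    _ = ∫⁻ v : Fin 2 → ℝ, ∫⁻ t : ℝ, F t v := by
        rw [Measure.volume_eq_prod, lintegral_prod_symm _ hFm.aemeasurable]
    _ ≤ ∫⁻ v : Fin 2 → ℝ, ENNReal.ofReal (π * (√B)⁻¹ *
          ((√(v 0 ^ 2 + v 1 ^ 2))⁻¹ * exp (-δ * (v 0 ^ 2 + v 1 ^ 2)))) := by
        refine lintegral_mono_ae ?_
        have hne : ∀ᵐ v : Fin 2 → ℝ, v ≠ 0 := by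
          simp [ae_iff, measure_singleton]
        filter_upwards [hne] with v hv
        have hq : 0 < v 0 ^ 2 + v 1 ^ 2 := by
          by_contra hcon
          apply hv
          have h0 : v 0 = 0 := by nlinarith [sq_nonneg (v 0), sq_nonneg (v 1)]
          have h1 : v 1 = 0 := by nlinarith [sq_nonneg (v 0), sq_nonneg (v 1)]
          ext i; fin_cases i <;> simp [h0, h1]
        simp only [hF]
        simp_rw [ENNReal.ofReal_mul (exp_nonneg _)]
        rw [lintegral_const_mul _ (by fun_prop), lintegral_inv_add_mul_sq hq hB0,
          ← ENNReal.ofReal_mul (exp_nonneg _)]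
        apply ENNReal.ofReal_le_ofReal
        apply le_of_eq
        ring
    _ = ∫⁻ v : EuclideanSpace ℝ (Fin 2), ENNReal.ofReal (π * (√B)⁻¹ *
          (‖v‖⁻¹ * exp (-δ * ‖v‖ ^ 2))) := by
        rw [← (PiLp.volume_preserving_ofLp (Fin 2)).lintegral_comp_emb
          (MeasurableEquiv.toLp 2 (Fin 2 → ℝ)).symm.measurableEmbedding]
        refine lintegral_congr fun v => ?_
        rw [EuclideanSpace.norm_eq, sq_sqrt (by positivity)]
        simp [Fin.sum_univ_two]
    _ = ENNReal.ofReal (π * (√B)⁻¹ * I) := by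
        rw [← ofReal_integral_eq_lintegral_ofReal (hR.const_mul _)
          (Eventually.of_forall fun t => by positivity), integral_const_mul]
    _ ≤ _ := by
        apply ENNReal.ofReal_le_ofReal
        have h1 := hc ‖ζ‖ (norm_nonneg _)
        have h2 : 0 < (1 + ‖ζ‖)⁻¹ := by positivity
        calc π * (√B)⁻¹ * I ≤ π * (c * (1 + ‖ζ‖)⁻¹) * I := by gcongr
          _ ≤ (π * c * I + 1) * (1 + ‖ζ‖)⁻¹ := by nlinarith

/-! ### The collision frequency: positive lower bound, Lipschitz bound, damping factor. -/

theorem angularCrossSection_eq (B₀ γ r : ℝ) : angularCrossSection B₀ γ r = π * B₀ * r ^ γ := by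
  have h : ∫ θ in (0 : ℝ)..(π / 2), crossSection B₀ γ r θ = B₀ * r ^ γ / 2 := by
    simp only [crossSection, mul_assoc]
    rw [intervalIntegral.integral_const_mul, intervalIntegral.integral_const_mul,
      integral_sin_mul_cos₁]
    simp
    ring
  rw [angularCrossSection, h, intervalIntegral.integral_const, smul_eq_mul]
  ring

theorem rpow_le_one_add {a γ : ℝ} (ha : 0 ≤ a) (hγ₀ : 0 ≤ γ) (hγ₁ : γ ≤ 1) : a ^ γ ≤ 1 + a := by
  rcases le_total a 1 with h | h
  · exact (rpow_le_one ha h hγ₀).trans (by linarith)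
  · have := rpow_le_rpow_of_exponent_le h hγ₁
    rw [rpow_one] at this
    linarith

theorem rpow_sub_one_le {a γ : ℝ} (ha : 0 ≤ a) (hγ₀ : 0 ≤ γ) (hγ₁ : γ ≤ 1) :
    a ^ (γ - 1) ≤ 1 + a⁻¹ := by
  rcases ha.eq_or_lt with rfl | ha
  -- Here `0⁻¹ = 0`, and `0 ^ (γ - 1)` is `0` or, for `γ = 1`, equal to `1`.
  · simpa using Real.zero_rpow_le_one (γ - 1)
  · rcases le_total a 1 with h | h
    · have := rpow_le_rpow_of_exponent_ge ha h (show (-1 : ℝ) ≤ γ - 1 by linarith)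
      rw [rpow_neg_one] at this
      linarith
    · have := rpow_le_one_of_one_le_of_nonpos h (show γ - 1 ≤ 0 by linarith)
      have := inv_pos.2 ha
      linarith

/-- For `A ≤ B` the power `x^{γ-1}` is larger at `A`, hence `B^γ - A^γ ≤ (B - A) B^{γ-1}`. The
symmetric right side has only integrable singularities when `A`, `B` are distances to two points. -/
theorem abs_rpow_sub_rpow_le {A B γ : ℝ} (hA : 0 < A) (hB : 0 < B) (hγ₀ : 0 ≤ γ) (hγ₁ : γ ≤ 1) :
    |A ^ γ - B ^ γ| ≤ |A - B| * (A ^ (γ - 1) + B ^ (γ - 1)) := by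
  wlog h : A ≤ B generalizing A B
  · rw [abs_sub_comm, abs_sub_comm A, add_comm (A ^ (γ - 1))]
    exact this hB hA (le_of_not_ge h)
  have e1 : ∀ {x : ℝ}, 0 < x → x ^ γ = x * x ^ (γ - 1) := fun {x} hx => by
    rw [rpow_sub_one hx.ne']; field_simp
  have h1 : B ^ (γ - 1) ≤ A ^ (γ - 1) := rpow_le_rpow_of_nonpos hA h (by linarith)
  have h2 : A ^ γ ≤ B ^ γ := rpow_le_rpow hA.le h hγ₀
  have h3 : 0 < A ^ (γ - 1) := rpow_pos_of_pos hA _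
  have h4 : 0 < B ^ (γ - 1) := rpow_pos_of_pos hB _
  rw [abs_of_nonpos (by linarith), abs_of_nonpos (by linarith), e1 hA, e1 hB]
  nlinarith

theorem maxwellian_pos (ζ : R3) : 0 < maxwellian ζ := by
  unfold maxwellian; positivity

theorem continuous_maxwellian : Continuous maxwellian := by
  unfold maxwellian; fun_prop

theorem continuous_norm_rpow_mul_maxwellian {γ : ℝ} (hγ₀ : 0 ≤ γ) (ζ : R3) :
    Continuous (fun ζs : R3 => ‖ζ - ζs‖ ^ γ * maxwellian ζs) := by
  refine Continuous.mul ?_ continuous_maxwellian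
  exact Continuous.rpow_const (by fun_prop) fun _ => Or.inr hγ₀

theorem integrable_norm_rpow_mul_maxwellian {γ : ℝ} (hγ₀ : 0 ≤ γ) (hγ₁ : γ ≤ 1) (ζ : R3) :
    Integrable (fun ζs : R3 => ‖ζ - ζs‖ ^ γ * maxwellian ζs) := by
  obtain ⟨C, hC0, hC⟩ := exists_one_add_pow_mul_exp_le 1 (show (0 : ℝ) < 1 / 2 by norm_num)
  have hG := (integrable_exp_neg_mul_norm_sq (volume : Measure R3)
    (show (0 : ℝ) < 1 / 2 by norm_num)).const_mul ((1 + ‖ζ‖) * π ^ (-(3 / 2) : ℝ) * C)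
  refine hG.mono' (continuous_norm_rpow_mul_maxwellian hγ₀ ζ).aestronglyMeasurable
    (Eventually.of_forall fun v => ?_)
  have h0 : 0 ≤ ‖ζ - v‖ ^ γ * maxwellian v :=
    mul_nonneg (rpow_nonneg (norm_nonneg _) _) (maxwellian_pos v).le
  rw [Real.norm_of_nonneg h0]
  have h1 : ‖ζ - v‖ ^ γ ≤ (1 + ‖ζ‖) * (1 + ‖v‖) := by
    have := rpow_le_one_add (norm_nonneg (ζ - v)) hγ₀ hγ₁
    have := norm_sub_le ζ v
    nlinarith [mul_nonneg (norm_nonneg ζ) (norm_nonneg v)]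
  have h2 := hC ‖v‖ (norm_nonneg _)
  rw [pow_one] at h2
  have h3 : exp (-‖v‖ ^ 2) = exp (-(1 / 2) * ‖v‖ ^ 2) * exp (-(1 / 2) * ‖v‖ ^ 2) := by
    rw [← exp_add]; ring_nf
  calc ‖ζ - v‖ ^ γ * maxwellian v ≤ (1 + ‖ζ‖) * (1 + ‖v‖) * maxwellian v :=
        mul_le_mul_of_nonneg_right h1 (maxwellian_pos v).le
    _ = ((1 + ‖ζ‖) * π ^ (-(3 / 2) : ℝ)) * ((1 + ‖v‖) * exp (-(1 / 2) * ‖v‖ ^ 2)) *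
          exp (-(1 / 2) * ‖v‖ ^ 2) := by rw [maxwellian, h3]; ring
    _ ≤ ((1 + ‖ζ‖) * π ^ (-(3 / 2) : ℝ)) * C * exp (-(1 / 2) * ‖v‖ ^ 2) := by gcongr

theorem nu_eq (B₀ γ : ℝ) (ζ : R3) :
    nu B₀ γ ζ = π * B₀ * ∫ ζs : R3, ‖ζ - ζs‖ ^ γ * maxwellian ζs := by
  rw [nu, ← integral_const_mul]
  simp only [angularCrossSection_eq, mul_assoc]

/-- The Maxwellian is even, so `ν(ζ)` may be averaged over `±ζ_*`. As `|ζ_*| ≤ |ζ - ζ_*| + |ζ +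
ζ_*|` and `r ↦ r^γ` is subadditive for `γ ≤ 1`, this gives `ν(ζ) ≥ ν(0)/2`. -/
theorem exists_le_nu {B₀ γ : ℝ} (hB₀ : 0 < B₀) (hγ₀ : 0 ≤ γ) (hγ₁ : γ ≤ 1) :
    ∃ ν₀ : ℝ, 0 < ν₀ ∧ ∀ ζ : R3, ν₀ ≤ nu B₀ γ ζ := by
  have hi := integrable_norm_rpow_mul_maxwellian hγ₀ hγ₁
  have h0 := hi 0
  have hpos : 0 < ∫ ζs : R3, ‖0 - ζs‖ ^ γ * maxwellian ζs := by
    refine integral_pos_of_integrable_nonneg_nonzero (x := (EuclideanSpace.single 0 1 : R3))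
      (continuous_norm_rpow_mul_maxwellian hγ₀ 0) h0
      (fun v => mul_nonneg (rpow_nonneg (norm_nonneg _) _) (maxwellian_pos v).le) ?_
    simpa using (maxwellian_pos _).ne'
  refine ⟨π * B₀ * ((∫ ζs : R3, ‖0 - ζs‖ ^ γ * maxwellian ζs) / 2), by positivity, fun ζ => ?_⟩
  rw [nu_eq]
  refine mul_le_mul_of_nonneg_left ?_ (by positivity)
  have hM : ∀ v : R3, maxwellian (-v) = maxwellian v := fun v => by simp [maxwellian]
  have hneg : ∫ ζs : R3, ‖ζ + ζs‖ ^ γ * maxwellian ζs =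
      ∫ ζs : R3, ‖ζ - ζs‖ ^ γ * maxwellian ζs := by
    rw [← integral_neg_eq_self (fun ζs : R3 => ‖ζ - ζs‖ ^ γ * maxwellian ζs)]
    simp [hM]
  have hin : Integrable (fun ζs : R3 => ‖ζ + ζs‖ ^ γ * maxwellian ζs) := by
    have := (hi ζ).comp_neg
    simpa [hM] using this
  have hle : ∫ ζs : R3, ‖0 - ζs‖ ^ γ * maxwellian ζs ≤
      ∫ ζs : R3, (‖ζ - ζs‖ ^ γ * maxwellian ζs + ‖ζ + ζs‖ ^ γ * maxwellian ζs) := by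
    refine integral_mono h0 ((hi ζ).add hin) fun v => ?_
    simp only [← add_mul]
    refine mul_le_mul_of_nonneg_right ?_ (maxwellian_pos v).le
    have h1 : ‖(0 : R3) - v‖ ≤ ‖ζ - v‖ + ‖ζ + v‖ := by
      have h2 : ‖(ζ + v) - (ζ - v)‖ ≤ ‖ζ + v‖ + ‖ζ - v‖ := norm_sub_le _ _
      have h3 : (ζ + v) - (ζ - v) = (2 : ℝ) • v := by module
      rw [h3, norm_smul] at h2
      norm_num at h2 ⊢
      linarith [norm_nonneg v]
    exact (rpow_le_rpow (norm_nonneg _) h1 hγ₀).trans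
      (Real.rpow_add_le_add_rpow (norm_nonneg _) (norm_nonneg _) hγ₀ hγ₁)
  rw [integral_add (hi ζ) hin, hneg] at hle
  linarith

theorem exists_abs_nu_sub_le {B₀ γ : ℝ} (hB₀ : 0 < B₀) (hγ₀ : 0 ≤ γ) (hγ₁ : γ ≤ 1) :
    ∃ C : ℝ, 0 < C ∧ ∀ ζ ζ' : R3, |nu B₀ γ ζ - nu B₀ γ ζ'| ≤ C * ‖ζ - ζ'‖ := by
  have hE : 2 ≤ Module.finrank ℝ R3 := by simp
  obtain ⟨C, hC0, hC⟩ := exists_integral_inv_norm_mul_exp_shift_le (volume : Measure R3) hE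
    (zero_lt_one)
  set m : ℝ := π ^ (-(3 / 2) : ℝ) with hm
  have hm0 : 0 < m := by positivity
  have hiR : ∀ b : R3, Integrable (fun v : R3 => (1 + ‖b - v‖⁻¹) * maxwellian v) ∧
      ∫ v : R3, (1 + ‖b - v‖⁻¹) * maxwellian v ≤ m * C := by
    intro b
    obtain ⟨h1, h2⟩ := hC (-b)
    have h3 := (h1.comp_sub_left b).const_mul m
    have e : ∀ v : R3, m * ((1 + ‖b - v‖⁻¹) * exp (-1 * ‖-b + (b - v)‖ ^ 2)) =
        (1 + ‖b - v‖⁻¹) * maxwellian v := by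
      intro v
      rw [maxwellian, ← hm, show -b + (b - v) = -v by abel, norm_neg, neg_one_mul]
      ring
    simp only [e] at h3
    refine ⟨h3, ?_⟩
    have h4 := integral_sub_left_eq_self
      (fun v : R3 => m * ((1 + ‖v‖⁻¹) * exp (-1 * ‖-b + v‖ ^ 2))) (μ := volume) b
    simp only [e] at h4
    rw [h4, integral_const_mul]
    gcongr
  refine ⟨π * B₀ * (m * C + m * C), by positivity, fun ζ ζ' => ?_⟩
  have hi := integrable_norm_rpow_mul_maxwellian hγ₀ hγ₁
  have hπB : 0 < π * B₀ := by positivity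
  rw [nu_eq, nu_eq, ← mul_sub, abs_mul, abs_of_pos hπB, mul_assoc (π * B₀) (m * C + m * C)]
  refine mul_le_mul_of_nonneg_left ?_ hπB.le
  rw [← integral_sub (hi ζ) (hi ζ')]
  have hb := ((hiR ζ).1.add (hiR ζ').1).const_mul ‖ζ - ζ'‖
  have hne : ∀ᵐ v : R3, v ≠ ζ ∧ v ≠ ζ' := by
    filter_upwards [compl_mem_ae_iff.2 (measure_singleton ζ),
      compl_mem_ae_iff.2 (measure_singleton ζ')] with v h1 h2 using ⟨h1, h2⟩
  have hle := norm_integral_le_of_norm_le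
    (f := fun v : R3 => ‖ζ - v‖ ^ γ * maxwellian v - ‖ζ' - v‖ ^ γ * maxwellian v) hb ?_
  · rw [Real.norm_eq_abs] at hle
    refine hle.trans ?_
    rw [integral_const_mul]
    simp only [Pi.add_apply]
    rw [integral_add (hiR ζ).1 (hiR ζ').1, mul_comm]
    exact mul_le_mul_of_nonneg_right (add_le_add (hiR ζ).2 (hiR ζ').2) (norm_nonneg _)
  · filter_upwards [hne] with v hv
    have hA : 0 < ‖ζ - v‖ := norm_pos_iff.2 (sub_ne_zero.2 hv.1.symm)
    have hB : 0 < ‖ζ' - v‖ := norm_pos_iff.2 (sub_ne_zero.2 hv.2.symm)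
    rw [← sub_mul, Real.norm_eq_abs, abs_mul, abs_of_pos (maxwellian_pos v)]
    have h1 := abs_rpow_sub_rpow_le hA hB hγ₀ hγ₁
    have h2 : |‖ζ - v‖ - ‖ζ' - v‖| ≤ ‖ζ - ζ'‖ := by
      have := abs_norm_sub_norm_le (ζ - v) (ζ' - v)
      rwa [sub_sub_sub_cancel_right] at this
    have h3 := rpow_sub_one_le hA.le hγ₀ hγ₁
    have h4 := rpow_sub_one_le hB.le hγ₀ hγ₁
    have h5 : 0 ≤ ‖ζ - v‖ ^ (γ - 1) := rpow_nonneg hA.le _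
    have h6 : 0 ≤ ‖ζ' - v‖ ^ (γ - 1) := rpow_nonneg hB.le _
    calc _ ≤ (‖ζ - ζ'‖ * ((1 + ‖ζ - v‖⁻¹) + (1 + ‖ζ' - v‖⁻¹))) * maxwellian v := by
          refine mul_le_mul_of_nonneg_right (h1.trans ?_) (maxwellian_pos v).le
          gcongr
      _ = _ := by simp only [Pi.add_apply]; ring

theorem continuous_nu {B₀ γ : ℝ} (hB₀ : 0 < B₀) (hγ₀ : 0 ≤ γ) (hγ₁ : γ ≤ 1) :
    Continuous (nu B₀ γ) := by
  obtain ⟨C, hC0, hC⟩ := exists_abs_nu_sub_le hB₀ hγ₀ hγ₁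
  refine (LipschitzWith.of_dist_le_mul (K := C.toNNReal) fun ζ ζ' => ?_).continuous
  rw [Real.dist_eq, dist_eq_norm, Real.coe_toNNReal _ hC0.le]
  exact hC ζ ζ'

/-- The damping factor `exp (-ν s)` and its velocity gradient decay uniformly in `s`. -/
theorem exists_slopeLE_exp_nu {B₀ γ : ℝ} (hB₀ : 0 < B₀) (hγ₀ : 0 ≤ γ) (hγ₁ : γ ≤ 1) :
    ∃ κ C : ℝ, 0 < κ ∧ 1 ≤ C ∧ ∀ (ζ : R3) (s : ℝ), 0 ≤ s →
      exp (-nu B₀ γ ζ * s) ≤ C * exp (-κ * s) ∧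
      SlopeLE (fun ζ' => exp (-nu B₀ γ ζ' * s)) ζ (C * exp (-κ * s)) := by
  obtain ⟨ν₀, hν0, hν⟩ := exists_le_nu hB₀ hγ₀ hγ₁
  obtain ⟨c, hc0, hc⟩ := exists_abs_nu_sub_le hB₀ hγ₀ hγ₁
  -- Differentiating `e^{-νs}` in velocity produces a factor `s`; half of the decay rate `ν₀`
  -- absorbs it, through `s e^{-ν₀s/2} ≤ 2/ν₀`.
  refine ⟨ν₀ / 2, 1 + 2 * c / ν₀, by positivity, by linarith [show 0 < 2 * c / ν₀ by positivity],
    fun ζ s hs => ?_⟩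
  have h1 : exp (-nu B₀ γ ζ * s) ≤ exp (-ν₀ * s) :=
    exp_le_exp.2 (mul_le_mul_of_nonneg_right (neg_le_neg (hν ζ)) hs)
  have h2 : exp (-ν₀ * s) = exp (-(ν₀ / 2) * s) * exp (-(ν₀ / 2) * s) := by
    rw [← exp_add]; ring_nf
  have h3 : exp (-(ν₀ / 2) * s) ≤ 1 := exp_le_one_iff.2 (by nlinarith)
  have h4 : s * exp (-(ν₀ / 2) * s) ≤ 2 / ν₀ := by
    have h5 : ν₀ / 2 * s ≤ exp (ν₀ / 2 * s) := by linarith [add_one_le_exp (ν₀ / 2 * s)]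
    rw [neg_mul, exp_neg, ← div_eq_mul_inv, div_le_iff₀ (exp_pos _), div_mul_eq_mul_div,
      le_div_iff₀ hν0]
    linarith
  have hp := exp_pos (-(ν₀ / 2) * s)
  have hcν : 0 < 2 * c / ν₀ := by positivity
  refine ⟨?_, ?_⟩
  · nlinarith
  · have hs1 : SlopeLE (nu B₀ γ) ζ c :=
      SlopeLE.of_bound (A := fun _ => c) continuousAt_const le_rfl
        (Eventually.of_forall fun q => by rw [dist_eq_norm]; exact hc q ζ)
    have hd : HasDerivAt (fun x : ℝ => exp (-x * s)) (exp (-nu B₀ γ ζ * s) * (-1 * s))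
        (nu B₀ γ ζ) := (((hasDerivAt_id _).neg).mul_const s).exp
    refine (SlopeLE.comp_hasDerivAt hd hs1).mono ?_
    rw [abs_mul, abs_of_pos (exp_pos _), abs_mul, abs_neg, abs_one, abs_of_nonneg hs, one_mul]
    calc exp (-nu B₀ γ ζ * s) * s * c ≤ exp (-ν₀ * s) * s * c := by gcongr
      _ = c * (s * exp (-(ν₀ / 2) * s)) * exp (-(ν₀ / 2) * s) := by rw [h2]; ring
      _ ≤ c * (2 / ν₀) * exp (-(ν₀ / 2) * s) := by gcongr
      _ ≤ (1 + 2 * c / ν₀) * exp (-(ν₀ / 2) * s) := by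
        refine mul_le_mul_of_nonneg_right ?_ hp.le
        have : c * (2 / ν₀) = 2 * c / ν₀ := by ring
        linarith

/-! ### The collision-plane integral and the geometry of the orthogonal component. -/

/-- The integral over the collision plane in the gain kernel, as a function of the relative
velocity `u` along the axis and the offset `l` of the Gaussian. -/
noncomputable def planeIntegral (γ u l : ℝ) : ℝ :=
  ∫ v : EuclideanSpace ℝ (Fin 2),
    (u ^ 2 + ‖v‖ ^ 2) ^ ((γ - 1) / 2) * exp (-‖!₂[l, 0] + v‖ ^ 2)

theorem rpow_plane_le {γ u r : ℝ} (hγ₀ : 0 ≤ γ) (hγ₁ : γ ≤ 1) (hr : 0 < r) :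
    (u ^ 2 + r ^ 2) ^ ((γ - 1) / 2) ≤ 1 + r⁻¹ := by
  have h1 : (u ^ 2 + r ^ 2) ^ ((γ - 1) / 2) ≤ (r ^ 2) ^ ((γ - 1) / 2) :=
    rpow_le_rpow_of_nonpos (by positivity) (by nlinarith [sq_nonneg u]) (by linarith)
  have h2 : (r ^ 2) ^ ((γ - 1) / 2) = r ^ (γ - 1) := by
    rw [← rpow_natCast, ← rpow_mul hr.le]
    congr 1
    push_cast
    ring
  rw [h2] at h1
  exact h1.trans (rpow_sub_one_le hr.le hγ₀ hγ₁)

/-- Scaling gives a bound uniform in `r`: for `u ≤ u'`, `u'² + r² ≤ (u'/u)²(u² + r²)`, so the power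
at `u'` is at least `(u'/u)^{γ-1} ≥ u/u'` times the power at `u`. -/
theorem abs_rpow_plane_sub_le {γ u u' r : ℝ} (hγ₀ : 0 ≤ γ) (hγ₁ : γ ≤ 1) (hu : 0 < u) (hu' : 0 < u')
    (hr : 0 < r) :
    |(u ^ 2 + r ^ 2) ^ ((γ - 1) / 2) - (u' ^ 2 + r ^ 2) ^ ((γ - 1) / 2)| ≤
      |u - u'| / min u u' * (1 + r⁻¹) := by
  wlog h : u ≤ u' generalizing u u'
  · rw [abs_sub_comm, abs_sub_comm u, min_comm]
    exact this hu' hu (le_of_not_ge h)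
  set p := (γ - 1) / 2 with hp
  have hp0 : p ≤ 0 := by rw [hp]; linarith
  have h1 : (u' ^ 2 + r ^ 2) ^ p ≤ (u ^ 2 + r ^ 2) ^ p :=
    rpow_le_rpow_of_nonpos (by positivity) (by nlinarith) hp0
  have hq : 1 ≤ u' / u := (one_le_div hu).2 h
  have h2 : (u' / u)⁻¹ * (u ^ 2 + r ^ 2) ^ p ≤ (u' ^ 2 + r ^ 2) ^ p := by
    have h3 : ((u' / u) ^ 2 * (u ^ 2 + r ^ 2)) ^ p ≤ (u' ^ 2 + r ^ 2) ^ p := by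
      refine rpow_le_rpow_of_nonpos (by positivity) ?_ hp0
      have e : (u' / u) ^ 2 * (u ^ 2 + r ^ 2) = u' ^ 2 + (u' / u) ^ 2 * r ^ 2 := by
        field_simp
      rw [e]
      have : 1 ≤ (u' / u) ^ 2 := one_le_pow₀ hq
      nlinarith [sq_nonneg r]
    refine le_trans ?_ h3
    rw [mul_rpow (by positivity) (by positivity)]
    refine mul_le_mul_of_nonneg_right ?_ (by positivity)
    have h4 : ((u' / u) ^ 2) ^ p = (u' / u) ^ (γ - 1) := by
      rw [← rpow_natCast, ← rpow_mul (by positivity)]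
      congr 1
      rw [hp]
      push_cast
      ring
    rw [h4, ← rpow_neg_one]
    exact rpow_le_rpow_of_exponent_le hq (by linarith)
  rw [abs_of_nonneg (by linarith), min_eq_left h, abs_sub_comm, abs_of_nonneg (by linarith)]
  have h5 := rpow_plane_le (u := u) hγ₀ hγ₁ hr
  have h6 : 1 - (u' / u)⁻¹ ≤ (u' - u) / u := by
    rw [inv_div, le_div_iff₀ hu, sub_mul, div_mul_eq_mul_div, sub_le_iff_le_add]
    have : u - u * u / u' ≤ u' - u := by
      rw [sub_le_iff_le_add, ← sub_le_iff_le_add', le_div_iff₀ hu']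
      nlinarith [sq_nonneg (u - u')]
    linarith
  have h7 : 0 ≤ (u' - u) / u := by
    have : 0 ≤ u' - u := by linarith
    positivity
  calc (u ^ 2 + r ^ 2) ^ p - (u' ^ 2 + r ^ 2) ^ p
      ≤ (1 - (u' / u)⁻¹) * (u ^ 2 + r ^ 2) ^ p := by linarith
    _ ≤ (u' - u) / u * (u ^ 2 + r ^ 2) ^ p := by gcongr
    _ ≤ _ := by gcongr

/-- With `e^{-x²} = (e^{-x²/2})²` the left side is a difference of squares, and `e^{-x²/2}` is
1-Lipschitz. The other factor keeps Gaussian decay for the integration over the plane. -/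
theorem abs_exp_neg_sq_sub_le (a b : ℝ) :
    |exp (-a ^ 2) - exp (-b ^ 2)| ≤
      |a - b| * (exp (-(1 / 2) * a ^ 2) + exp (-(1 / 2) * b ^ 2)) := by
  have hL : |exp (-(1 / 2) * a ^ 2) - exp (-(1 / 2) * b ^ 2)| ≤ |a - b| := by
    have hd : ∀ x ∈ (univ : Set ℝ), HasDerivWithinAt (fun x : ℝ => exp (-(1 / 2) * x ^ 2))
        (exp (-(1 / 2) * x ^ 2) * (-(1 / 2) * (2 * x))) univ x := by
      intro x _
      have := (((hasDerivAt_pow 2 x).const_mul (-(1 / 2) : ℝ))).exp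
      simpa using this
    have := convex_univ.norm_image_sub_le_of_norm_hasDerivWithin_le (C := 1) hd ?_
      (mem_univ b) (mem_univ a)
    · simpa using this
    · intro x _
      rw [norm_mul, Real.norm_of_nonneg (exp_nonneg _)]
      have h1 : ‖-(1 / 2) * (2 * x)‖ = |x| := by
        rw [Real.norm_eq_abs, ← abs_neg]; congr 1; ring
      rw [h1, neg_mul, exp_neg, inv_mul_le_iff₀ (exp_pos _), mul_one]
      have := add_one_le_exp (1 / 2 * x ^ 2)
      rw [← sq_abs] at this ⊢
      nlinarith [sq_nonneg (|x| - 1)]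
  have e : ∀ x : ℝ, exp (-x ^ 2) = exp (-(1 / 2) * x ^ 2) * exp (-(1 / 2) * x ^ 2) := fun x => by
    rw [← exp_add]; ring_nf
  rw [e a, e b, mul_self_sub_mul_self, abs_mul, mul_comm]
  rw [abs_of_nonneg (show 0 ≤ exp (-(1 / 2) * a ^ 2) + exp (-(1 / 2) * b ^ 2) by positivity)]
  gcongr

theorem norm_plane_sub (l l' : ℝ) :
    ‖(!₂[l, 0] : EuclideanSpace ℝ (Fin 2)) - !₂[l', 0]‖ = |l - l'| := by
  rw [EuclideanSpace.norm_eq]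
  simp [Fin.sum_univ_two, sqrt_sq_eq_abs]

theorem measurable_plane_integrand (γ u l : ℝ) :
    Measurable (fun v : EuclideanSpace ℝ (Fin 2) =>
      (u ^ 2 + ‖v‖ ^ 2) ^ ((γ - 1) / 2) * exp (-‖!₂[l, 0] + v‖ ^ 2)) := by
  fun_prop

/-- The integrand is dominated by `1 + |v|⁻¹` times a shifted Gaussian, which is integrable in
dimension two uniformly in the shift. The arguments `u` and `l` are varied one at a time. -/
theorem exists_planeIntegral_le {γ : ℝ} (hγ₀ : 0 ≤ γ) (hγ₁ : γ ≤ 1) :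
    ∃ C : ℝ, 0 < C ∧ (∀ u l : ℝ, 0 ≤ planeIntegral γ u l ∧ planeIntegral γ u l ≤ C) ∧
      ∀ u u' l l' : ℝ, 0 < u → 0 < u' →
        |planeIntegral γ u l - planeIntegral γ u' l'| ≤ C * (|u - u'| / min u u' + |l - l'|) := by
  have hE : 2 ≤ Module.finrank ℝ (EuclideanSpace ℝ (Fin 2)) := by simp
  obtain ⟨C₁, hC1, hJ⟩ := exists_integral_inv_norm_mul_exp_shift_le
    (volume : Measure (EuclideanSpace ℝ (Fin 2))) hE zero_lt_one
  obtain ⟨C₂, hC2, hH⟩ := exists_integral_inv_norm_mul_exp_shift_le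
    (volume : Measure (EuclideanSpace ℝ (Fin 2))) hE (show (0 : ℝ) < 1 / 2 by norm_num)
  simp only [neg_one_mul] at hJ
  have hne : ∀ᵐ v : EuclideanSpace ℝ (Fin 2), 0 < ‖v‖ := by
    filter_upwards [compl_mem_ae_iff.2 (measure_singleton (0 : EuclideanSpace ℝ (Fin 2)))] with v hv
    exact norm_pos_iff.2 hv
  have hint : ∀ u l : ℝ, Integrable (fun v : EuclideanSpace ℝ (Fin 2) =>
      (u ^ 2 + ‖v‖ ^ 2) ^ ((γ - 1) / 2) * exp (-‖!₂[l, 0] + v‖ ^ 2)) := by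
    intro u l
    refine (hJ !₂[l, 0]).1.mono' (measurable_plane_integrand γ u l).aestronglyMeasurable ?_
    filter_upwards [hne] with v hv
    rw [Real.norm_of_nonneg (by positivity)]
    have := rpow_plane_le (u := u) hγ₀ hγ₁ hv
    gcongr
  refine ⟨C₁ + 2 * C₂, by positivity, fun u l => ⟨integral_nonneg fun v => by positivity, ?_⟩, ?_⟩
  · calc planeIntegral γ u l
        ≤ ∫ v : EuclideanSpace ℝ (Fin 2), (1 + ‖v‖⁻¹) * exp (-‖!₂[l, 0] + v‖ ^ 2) := by
          refine integral_mono_ae (hint u l) (hJ _).1 ?_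
          filter_upwards [hne] with v hv
          have := rpow_plane_le (u := u) hγ₀ hγ₁ hv
          gcongr
      _ ≤ C₁ := (hJ _).2
      _ ≤ _ := by linarith
  · intro u u' l l' hu hu'
    have hmin : 0 < min u u' := lt_min hu hu'
    have h1 : |planeIntegral γ u l - planeIntegral γ u' l| ≤ |u - u'| / min u u' * C₁ := by
      rw [planeIntegral, planeIntegral, ← integral_sub (hint u l) (hint u' l)]
      have hb := (hJ !₂[l, 0]).1.const_mul (|u - u'| / min u u')
      have := norm_integral_le_of_norm_le (f := fun v : EuclideanSpace ℝ (Fin 2) =>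
        (u ^ 2 + ‖v‖ ^ 2) ^ ((γ - 1) / 2) * exp (-‖!₂[l, 0] + v‖ ^ 2) -
        (u' ^ 2 + ‖v‖ ^ 2) ^ ((γ - 1) / 2) * exp (-‖!₂[l, 0] + v‖ ^ 2)) hb ?_
      · rw [integral_const_mul, Real.norm_eq_abs] at this
        refine this.trans ?_
        have := (hJ !₂[l, 0]).2
        gcongr
      · filter_upwards [hne] with v hv
        have := abs_rpow_plane_sub_le hγ₀ hγ₁ hu hu' hv
        rw [← sub_mul, norm_mul, Real.norm_eq_abs, Real.norm_of_nonneg (exp_nonneg _), ← mul_assoc]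
        gcongr
    have h2 : |planeIntegral γ u' l - planeIntegral γ u' l'| ≤ |l - l'| * (C₂ + C₂) := by
      rw [planeIntegral, planeIntegral, ← integral_sub (hint u' l) (hint u' l')]
      have hb := ((hH !₂[l, 0]).1.add (hH !₂[l', 0]).1).const_mul |l - l'|
      have := norm_integral_le_of_norm_le (f := fun v : EuclideanSpace ℝ (Fin 2) =>
        (u' ^ 2 + ‖v‖ ^ 2) ^ ((γ - 1) / 2) * exp (-‖!₂[l, 0] + v‖ ^ 2) -
        (u' ^ 2 + ‖v‖ ^ 2) ^ ((γ - 1) / 2) * exp (-‖!₂[l', 0] + v‖ ^ 2)) hb ?_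
      · rw [integral_const_mul, Real.norm_eq_abs] at this
        refine this.trans ?_
        simp only [Pi.add_apply]
        rw [integral_add (hH _).1 (hH _).1]
        have a1 := (hH !₂[l, 0]).2
        have a2 := (hH !₂[l', 0]).2
        gcongr
      · filter_upwards [hne] with v hv
        have a1 := rpow_plane_le (u := u') hγ₀ hγ₁ hv
        have a2 := abs_exp_neg_sq_sub_le ‖!₂[l, 0] + v‖ ‖!₂[l', 0] + v‖
        have a3 : |‖!₂[l, 0] + v‖ - ‖!₂[l', 0] + v‖| ≤ |l - l'| := by
          have := abs_norm_sub_norm_le (!₂[l, 0] + v) (!₂[l', 0] + v)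
          rwa [add_sub_add_right_eq_sub, norm_plane_sub] at this
        have a4 : 0 ≤ (u' ^ 2 + ‖v‖ ^ 2) ^ ((γ - 1) / 2) := by positivity
        rw [← mul_sub, norm_mul, Real.norm_eq_abs, Real.norm_eq_abs, abs_of_nonneg a4]
        calc _ ≤ (1 + ‖v‖⁻¹) * (|l - l'| * (exp (-(1 / 2) * ‖!₂[l, 0] + v‖ ^ 2) +
              exp (-(1 / 2) * ‖!₂[l', 0] + v‖ ^ 2))) := by
              refine mul_le_mul a1 (a2.trans ?_) (abs_nonneg _) (by positivity)
              gcongr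
          _ = _ := by simp only [Pi.add_apply]; ring
    have h3 : |planeIntegral γ u l - planeIntegral γ u' l'| ≤
        |u - u'| / min u u' * C₁ + |l - l'| * (C₂ + C₂) :=
      (abs_sub_le _ (planeIntegral γ u' l) _).trans (add_le_add h1 h2)
    refine h3.trans ?_
    have a1 : 0 ≤ |u - u'| / min u u' := by positivity
    nlinarith [mul_nonneg a1 hC2.le, mul_nonneg (abs_nonneg (l - l')) hC1.le]

theorem perpLength_le_norm_sub_smul (ζ w : R3) (hw : w ≠ 0) (c : ℝ) :
    perpLength ζ w ≤ ‖ζ - c • w‖ := by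
  have hw' : 0 < ‖w‖ := norm_pos_iff.2 hw
  set t := inner ℝ ζ w / ‖w‖ ^ 2 with ht
  have horth : inner ℝ (ζ - t • w) ((t - c) • w) = 0 := by
    rw [inner_smul_right, inner_sub_left, inner_smul_left, real_inner_self_eq_norm_sq, ht]
    simp only [conj_trivial]
    field_simp
    simp
  have e : ζ - c • w = (ζ - t • w) + (t - c) • w := by module
  have := norm_add_sq_real (ζ - t • w) ((t - c) • w)
  rw [horth, ← e] at this
  rw [perpLength, ← ht]
  refine le_of_sq_le_sq ?_ (norm_nonneg _)
  nlinarith [sq_nonneg ‖(t - c) • w‖]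

/-- `perpLength ζ a` is the distance from `ζ` to the line `ℝa`, so testing it with the multiple `t`
that is optimal for `b` costs at most `|t| ‖a - b‖`, where `|t| ≤ ‖ζ‖/‖b‖`. -/
theorem abs_perpLength_sub_le (ζ w w' : R3) (hw : w ≠ 0) (hw' : w' ≠ 0) :
    |perpLength ζ w - perpLength ζ w'| ≤ ‖ζ‖ * ‖w - w'‖ / min ‖w‖ ‖w'‖ := by
  have key : ∀ a b : R3, a ≠ 0 → b ≠ 0 →
      perpLength ζ a - perpLength ζ b ≤ ‖ζ‖ * ‖a - b‖ / min ‖a‖ ‖b‖ := by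
    intro a b ha hb
    have ha' : 0 < ‖a‖ := norm_pos_iff.2 ha
    have hb' : 0 < ‖b‖ := norm_pos_iff.2 hb
    set t := inner ℝ ζ b / ‖b‖ ^ 2 with ht
    have h1 := perpLength_le_norm_sub_smul ζ a ha t
    have h2 : ‖ζ - t • a‖ ≤ ‖ζ - t • b‖ + |t| * ‖a - b‖ := by
      have e : ζ - t • a = (ζ - t • b) - t • (a - b) := by module
      rw [e]
      refine (norm_sub_le _ _).trans ?_
      rw [norm_smul, Real.norm_eq_abs]
    have h3 : |t| ≤ ‖ζ‖ / min ‖a‖ ‖b‖ := by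
      rw [ht, abs_div, abs_of_nonneg (sq_nonneg ‖b‖)]
      calc |inner ℝ ζ b| / ‖b‖ ^ 2 ≤ ‖ζ‖ * ‖b‖ / ‖b‖ ^ 2 := by
            gcongr; exact abs_real_inner_le_norm ζ b
        _ = ‖ζ‖ / ‖b‖ := by field_simp
        _ ≤ _ := by
          gcongr
          exact min_le_right _ _
    have h4 : perpLength ζ b = ‖ζ - t • b‖ := rfl
    have h5 : |t| * ‖a - b‖ ≤ ‖ζ‖ / min ‖a‖ ‖b‖ * ‖a - b‖ := by gcongr
    rw [mul_div_right_comm]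
    linarith
  rw [abs_le]
  constructor
  · have := key w' w hw' hw
    rw [norm_sub_rev, min_comm] at this
    linarith
  · exact key w w' hw hw'

theorem norm_smul_sub_smul_le (w q : R3) (hw : w ≠ 0) :
    ‖‖q‖⁻¹ • q - ‖w‖⁻¹ • w‖ ≤ 2 * ‖q - w‖ / ‖w‖ := by
  have hw' : 0 < ‖w‖ := norm_pos_iff.2 hw
  -- At `q = 0` the normalised vector is `0` by convention, and the claim reads `1 ≤ 2`.
  rcases eq_or_ne q 0 with rfl | hq
  · simp [norm_smul]
    field_simp
    norm_num
  have hq' : 0 < ‖q‖ := norm_pos_iff.2 hq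
  have e : ‖q‖⁻¹ • q - ‖w‖⁻¹ • w = ‖w‖⁻¹ • (q - w) + (‖q‖⁻¹ - ‖w‖⁻¹) • q := by module
  rw [e]
  refine (norm_add_le _ _).trans ?_
  rw [norm_smul, norm_smul, Real.norm_of_nonneg (by positivity), Real.norm_eq_abs]
  have h1 : |‖q‖⁻¹ - ‖w‖⁻¹| * ‖q‖ = |‖w‖ - ‖q‖| / ‖w‖ := by
    rw [inv_sub_inv hq'.ne' hw'.ne', abs_div, abs_of_pos (mul_pos hq' hw')]
    field_simp
  have h2 : |‖w‖ - ‖q‖| ≤ ‖q - w‖ := by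
    rw [norm_sub_rev]; exact abs_norm_sub_norm_le _ _
  rw [h1]
  have h3 : |‖w‖ - ‖q‖| / ‖w‖ ≤ ‖q - w‖ / ‖w‖ := by gcongr
  calc _ ≤ ‖w‖⁻¹ * ‖q - w‖ + ‖q - w‖ / ‖w‖ := by linarith
    _ = _ := by ring

/-! ### The kernel of `K`: symmetry, pointwise bound and velocity gradient. -/

noncomputable section

/-- Up to sign, `(‖ζ‖² - ‖ζ + w‖²) / ‖w‖`. -/
def energyGap (ζ w : R3) : ℝ := 2 * inner ℝ ζ (‖w‖⁻¹ • w) + ‖w‖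

/-- The gain kernel as a function of `w = ζ_* - ζ`. -/
def gainShift (B₀ γ : ℝ) (ζ w : R3) : ℝ :=
  2 * B₀ * π ^ (-(3 / 2) : ℝ) * (‖w‖⁻¹ * (exp (-(1 / 4) * ‖w‖ ^ 2) *
    exp (-(1 / 4) * energyGap ζ w ^ 2)) * planeIntegral γ ‖w‖ (perpLength ζ w))

/-- The loss kernel as a function of `w = ζ_* - ζ`. -/
def lossShift (B₀ γ : ℝ) (ζ w : R3) : ℝ :=
  π * B₀ * π ^ (-(3 / 2) : ℝ) * (‖w‖ ^ γ * exp (-(1 / 2) * (‖ζ‖ ^ 2 + ‖ζ + w‖ ^ 2)))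

/-- The weight `|w|⁻² e^{-β (|w|² + m²)}`, `w = ζ_* - ζ`, `m = (|ζ|² - |ζ_*|²) / |w|`, that dominates
the kernel of `K` and its velocity gradient. -/
def kernelWeight (β : ℝ) (ζ ζs : R3) : ℝ :=
  (‖ζs - ζ‖ ^ 2)⁻¹ * exp (-β * (‖ζs - ζ‖ ^ 2 + ((‖ζ‖ ^ 2 - ‖ζs‖ ^ 2) / ‖ζs - ζ‖) ^ 2))

end

theorem energyGap_sq (ζ ζs : R3) :
    energyGap ζ (ζs - ζ) ^ 2 = ((‖ζ‖ ^ 2 - ‖ζs‖ ^ 2) / ‖ζs - ζ‖) ^ 2 := by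
  rcases eq_or_ne ζs ζ with rfl | h
  · simp [energyGap]
  have hw : 0 < ‖ζs - ζ‖ := norm_pos_iff.2 (sub_ne_zero.2 h)
  have h1 : ‖ζs‖ ^ 2 = ‖ζ‖ ^ 2 + 2 * inner ℝ ζ (ζs - ζ) + ‖ζs - ζ‖ ^ 2 := by
    have := norm_add_sq_real ζ (ζs - ζ)
    rwa [add_sub_cancel] at this
  have h2 : energyGap ζ (ζs - ζ) = -((‖ζ‖ ^ 2 - ‖ζs‖ ^ 2) / ‖ζs - ζ‖) := by
    rw [energyGap, h1, inner_smul_right]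
    field_simp
    ring
  rw [h2, neg_sq]

theorem kernelWeight_symm (β : ℝ) (ζ ζs : R3) : kernelWeight β ζ ζs = kernelWeight β ζs ζ := by
  rw [kernelWeight, kernelWeight, norm_sub_rev ζs ζ, div_pow, div_pow,
    show (‖ζ‖ ^ 2 - ‖ζs‖ ^ 2) ^ 2 = (‖ζs‖ ^ 2 - ‖ζ‖ ^ 2) ^ 2 by ring]

theorem kernelWeight_nonneg (β : ℝ) (ζ ζs : R3) : 0 ≤ kernelWeight β ζ ζs := by
  unfold kernelWeight; positivity

theorem kernelK_eq (B₀ γ : ℝ) (ζ ζs : R3) :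
    kernelK B₀ γ ζ ζs = gainShift B₀ γ ζ (ζs - ζ) - lossShift B₀ γ ζ (ζs - ζ) := by
  have hs : ∀ v : R3, √(maxwellian v) = √(π ^ (-(3 / 2) : ℝ)) * exp (-(1 / 2) * ‖v‖ ^ 2) := by
    intro v
    rw [maxwellian, sqrt_mul (by positivity)]
    congr 1
    rw [sqrt_eq_iff_mul_self_eq (by positivity) (by positivity), ← exp_add]
    ring_nf
  have hp : √(π ^ (-(3 / 2) : ℝ)) * √(π ^ (-(3 / 2) : ℝ)) = π ^ (-(3 / 2) : ℝ) :=
    mul_self_sqrt (by positivity)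
  rw [kernelK]
  congr 1
  · rw [kGain, gainShift, planeIntegral, energyGap_sq, norm_sub_rev ζ ζs, mul_add, exp_add]
    ring
  · rw [kLoss, lossShift, angularCrossSection_eq, hs, hs, norm_sub_rev ζ ζs, add_sub_cancel,
      mul_add, exp_add]
    calc _ = π * B₀ * (√(π ^ (-(3 / 2) : ℝ)) * √(π ^ (-(3 / 2) : ℝ))) * (‖ζs - ζ‖ ^ γ *
          (exp (-(1 / 2) * ‖ζ‖ ^ 2) * exp (-(1 / 2) * ‖ζs‖ ^ 2))) := by ring
      _ = _ := by rw [hp]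

theorem perpLength_symm (ζ ζs : R3) : perpLength ζ (ζs - ζ) = perpLength ζs (ζ - ζs) := by
  rcases eq_or_ne ζs ζ with rfl | h
  · rfl
  have hw : 0 < ‖ζs - ζ‖ := norm_pos_iff.2 (sub_ne_zero.2 h)
  rw [perpLength, perpLength, norm_sub_rev ζ ζs]
  congr 1
  have h1 : inner ℝ ζs (ζ - ζs) = -inner ℝ ζ (ζs - ζ) - ‖ζs - ζ‖ ^ 2 := by
    rw [← real_inner_self_eq_norm_sq, ← inner_neg_right, neg_sub, ← neg_sub ζs ζ]
    simp only [inner_neg_right, inner_sub_left]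
    ring
  rw [h1, sub_div, div_self (by positivity)]
  module

/-- Allows `k(q,η)` to be differentiated in `q` as a function of its second argument. -/
theorem kernelK_symm (B₀ γ : ℝ) (ζ ζs : R3) : kernelK B₀ γ ζ ζs = kernelK B₀ γ ζs ζ := by
  have h1 : ∀ a b : R3, (‖a‖ ^ 2 + ‖a + (b - a)‖ ^ 2) = ‖a‖ ^ 2 + ‖b‖ ^ 2 := fun a b => by
    rw [add_sub_cancel]
  rw [kernelK_eq, kernelK_eq, gainShift, gainShift, lossShift, lossShift, h1, h1, energyGap_sq,
    energyGap_sq, perpLength_symm, norm_sub_rev ζs ζ, add_comm (‖ζ‖ ^ 2), div_pow, div_pow,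
    show (‖ζ‖ ^ 2 - ‖ζs‖ ^ 2) ^ 2 = (‖ζs‖ ^ 2 - ‖ζ‖ ^ 2) ^ 2 by ring]

theorem measurable_kernelK (B₀ γ : ℝ) :
    Measurable (fun p : R3 × R3 => kernelK B₀ γ p.1 p.2) := by
  have hperp : Measurable (fun p : R3 × R3 => perpLength p.1 (p.2 - p.1)) := by
    unfold perpLength; fun_prop
  have hgap : Measurable (fun p : R3 × R3 => energyGap p.1 (p.2 - p.1)) := by
    unfold energyGap; fun_prop
  have hplane : Measurable (fun p : ℝ × ℝ => planeIntegral γ p.1 p.2) := by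
    have h1 : Measurable (fun q : (ℝ × ℝ) × EuclideanSpace ℝ (Fin 2) =>
        (!₂[q.1.2, 0] : EuclideanSpace ℝ (Fin 2))) := by
      refine (PiLp.continuous_toLp 2 _).measurable.comp (measurable_pi_iff.2 fun i => ?_)
      fin_cases i
      · exact measurable_fst.snd
      · exact measurable_const
    have : StronglyMeasurable (fun q : (ℝ × ℝ) × EuclideanSpace ℝ (Fin 2) =>
        (q.1.1 ^ 2 + ‖q.2‖ ^ 2) ^ ((γ - 1) / 2) * exp (-‖!₂[q.1.2, 0] + q.2‖ ^ 2)) := by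
      refine Measurable.stronglyMeasurable ?_
      fun_prop
    exact this.integral_prod_right.measurable
  have hJ : Measurable (fun p : R3 × R3 =>
      planeIntegral γ ‖p.2 - p.1‖ (perpLength p.1 (p.2 - p.1))) :=
    hplane.comp (Measurable.prodMk (by fun_prop) hperp)
  simp only [kernelK_eq, gainShift, lossShift]
  fun_prop

theorem abs_inner_unit_le (ζ w : R3) : |inner ℝ ζ (‖w‖⁻¹ • w)| ≤ ‖ζ‖ := by
  refine (abs_real_inner_le_norm _ _).trans ?_
  have : ‖‖w‖⁻¹ • w‖ ≤ 1 := by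
    rw [norm_smul, norm_inv, norm_norm]
    exact inv_mul_le_one
  nlinarith [norm_nonneg ζ]

/-- For `w ≠ 0` the difference of the two sides is the squared length of the part of `ζ` orthogonal
to `w`. The loss kernel is thereby dominated by the Gaussian that occurs in the gain kernel. -/
theorem sq_add_energyGap_sq_le (ζ w : R3) :
    (1 / 4) * (‖w‖ ^ 2 + energyGap ζ w ^ 2) ≤ (1 / 2) * (‖ζ‖ ^ 2 + ‖ζ + w‖ ^ 2) := by
  rcases eq_or_ne w 0 with rfl | hw
  · simp [energyGap]
  have hw' : 0 < ‖w‖ := norm_pos_iff.2 hw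
  have h1 := norm_add_sq_real ζ w
  have h2 : inner ℝ ζ w = inner ℝ ζ (‖w‖⁻¹ • w) * ‖w‖ := by
    rw [inner_smul_right]; field_simp
  have h3 : inner ℝ ζ (‖w‖⁻¹ • w) ^ 2 ≤ ‖ζ‖ ^ 2 := by
    rw [← sq_abs]
    exact pow_le_pow_left₀ (abs_nonneg _) (abs_inner_unit_le ζ w) 2
  rw [h1, h2, energyGap]
  nlinarith

theorem slopeLE_norm (w : R3) : SlopeLE (fun q : R3 => ‖q‖) w 1 :=
  SlopeLE.of_bound (A := fun _ => 1) continuousAt_const le_rfl <| Eventually.of_forall fun q => by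
    rw [one_mul, dist_eq_norm]; exact abs_norm_sub_norm_le _ _

theorem slopeLE_energyGap (ζ w : R3) (hw : w ≠ 0) :
    SlopeLE (energyGap ζ) w (4 * ‖ζ‖ / ‖w‖ + 1) := by
  refine SlopeLE.of_bound (A := fun _ => 4 * ‖ζ‖ / ‖w‖ + 1) continuousAt_const le_rfl <|
    Eventually.of_forall fun q => ?_
  rw [dist_eq_norm]
  have h1 : energyGap ζ q - energyGap ζ w =
      2 * inner ℝ ζ (‖q‖⁻¹ • q - ‖w‖⁻¹ • w) + (‖q‖ - ‖w‖) := by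
    rw [energyGap, energyGap, inner_sub_right]; ring
  have h2 := (abs_real_inner_le_norm ζ (‖q‖⁻¹ • q - ‖w‖⁻¹ • w)).trans
    (mul_le_mul_of_nonneg_left (norm_smul_sub_smul_le w q hw) (norm_nonneg ζ))
  have h3 := abs_norm_sub_norm_le q w
  rw [h1]
  calc _ ≤ |2 * inner ℝ ζ (‖q‖⁻¹ • q - ‖w‖⁻¹ • w)| + |‖q‖ - ‖w‖| := abs_add_le _ _
    _ ≤ 2 * (‖ζ‖ * (2 * ‖q - w‖ / ‖w‖)) + ‖q - w‖ := by
      rw [abs_mul, abs_of_pos (zero_lt_two)]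
      gcongr
    _ = _ := by ring

theorem slopeLE_exp_quarter_sq {g : R3 → ℝ} {w : R3} {c : ℝ} (hg : SlopeLE g w c) :
    SlopeLE (fun q => exp (-(1 / 4) * g q ^ 2)) w
      (exp (-(1 / 4) * g w ^ 2) * (|g w| / 2) * c) := by
  have hd : HasDerivAt (fun x : ℝ => exp (-(1 / 4) * x ^ 2))
      (exp (-(1 / 4) * g w ^ 2) * (-(1 / 4) * (2 * g w))) (g w) := by
    have := (((hasDerivAt_pow 2 (g w)).const_mul (-(1 / 4) : ℝ))).exp
    simpa using this
  refine (SlopeLE.comp_hasDerivAt hd hg).mono (le_of_eq ?_)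
  rw [abs_mul, abs_of_pos (exp_pos _),
    show -(1 / 4) * (2 * g w) = -(1 / 2) * g w by ring, abs_mul]
  norm_num
  ring_nf
  tauto

theorem slopeLE_planeIntegral {γ C : ℝ} (hC0 : 0 < C)
    (hC : ∀ u u' l l' : ℝ, 0 < u → 0 < u' →
      |planeIntegral γ u l - planeIntegral γ u' l'| ≤ C * (|u - u'| / min u u' + |l - l'|))
    (ζ w : R3) (hw : w ≠ 0) :
    SlopeLE (fun q => planeIntegral γ ‖q‖ (perpLength ζ q)) w (C * (1 + ‖ζ‖) / ‖w‖) := by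
  have hw' : 0 < ‖w‖ := norm_pos_iff.2 hw
  have hcont : ContinuousAt (fun q : R3 => C * (1 + ‖ζ‖) / min ‖q‖ ‖w‖) w := by
    refine ContinuousAt.div₀ continuousAt_const (by fun_prop) ?_
    simpa using hw
  refine SlopeLE.of_bound hcont (by simp) ?_
  filter_upwards [eventually_ne_nhds hw] with q hq
  have hq' : 0 < ‖q‖ := norm_pos_iff.2 hq
  refine (hC _ _ _ _ hq' hw').trans ?_
  rw [dist_eq_norm]
  have h1 := abs_perpLength_sub_le ζ q w hq hw
  have h2 := abs_norm_sub_norm_le q w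
  have h3 : 0 < min ‖q‖ ‖w‖ := lt_min hq' hw'
  have h4 : |‖q‖ - ‖w‖| / min ‖q‖ ‖w‖ ≤ ‖q - w‖ / min ‖q‖ ‖w‖ := by gcongr
  calc _ ≤ C * (‖q - w‖ / min ‖q‖ ‖w‖ + ‖ζ‖ * ‖q - w‖ / min ‖q‖ ‖w‖) := by gcongr
    _ = _ := by ring

/-- By the product rule, each of the four factors costs at most `(1 + ‖ζ‖)/‖w‖` up to polynomials in
`‖w‖` and the energy gap; the factor `‖ζ‖` enters through the direction `w/‖w‖` and through
`perpLength`. The bound has the same form as in `slopeLE_lossShift`, so that the two add up. -/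
theorem slopeLE_gainShift {B₀ γ C : ℝ} (hB₀ : 0 < B₀) (hC0 : 0 < C)
    (hJ : ∀ u l : ℝ, 0 ≤ planeIntegral γ u l ∧ planeIntegral γ u l ≤ C)
    (hC : ∀ u u' l l' : ℝ, 0 < u → 0 < u' →
      |planeIntegral γ u l - planeIntegral γ u' l'| ≤ C * (|u - u'| / min u u' + |l - l'|))
    (ζ w : R3) (hw : w ≠ 0) :
    SlopeLE (gainShift B₀ γ ζ) w (10 * B₀ * π ^ (-(3 / 2) : ℝ) * C *
      ((1 + ‖ζ‖) * (‖w‖ ^ 2)⁻¹ * ((1 + ‖w‖) ^ 4 * (1 + |energyGap ζ w|) *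
        exp (-(1 / 4) * (‖w‖ ^ 2 + energyGap ζ w ^ 2))))) := by
  have hw' : 0 < ‖w‖ := norm_pos_iff.2 hw
  have s0 : SlopeLE (fun q : R3 => ‖q‖⁻¹) w ((‖w‖ ^ 2)⁻¹) := by
    refine (SlopeLE.comp_hasDerivAt (hasDerivAt_inv hw'.ne') (slopeLE_norm w)).mono (le_of_eq ?_)
    rw [abs_neg, abs_of_pos (by positivity), mul_one]
  have s1 := slopeLE_exp_quarter_sq (slopeLE_norm w)
  have s2 := slopeLE_exp_quarter_sq (slopeLE_energyGap ζ w hw)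
  have s3 := slopeLE_planeIntegral hC0 hC ζ w hw
  have s4 := ((s0.mul (s1.mul s2)).mul s3).const_mul (2 * B₀ * π ^ (-(3 / 2) : ℝ))
  refine SlopeLE.mono s4 ?_
  obtain ⟨j0, j1⟩ := hJ ‖w‖ (perpLength ζ w)
  rw [abs_of_pos (show 0 < 2 * B₀ * π ^ (-(3 / 2) : ℝ) by positivity), mul_add (-(1 / 4) : ℝ),
    exp_add]
  set J := planeIntegral γ ‖w‖ (perpLength ζ w)
  set a := exp (-(1 / 4) * ‖w‖ ^ 2) with ha
  set b := exp (-(1 / 4) * energyGap ζ w ^ 2) with hb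
  set M := |energyGap ζ w|
  have hM : 0 ≤ M := abs_nonneg _
  set U := ‖w‖
  set Z := ‖ζ‖
  have hZ : 0 ≤ Z := norm_nonneg _
  have ha0 : 0 < a := exp_pos _
  have hb0 : 0 < b := exp_pos _
  rw [abs_of_nonneg j0, abs_of_pos (show 0 < U⁻¹ * (a * b) by positivity),
    abs_of_pos (show 0 < U⁻¹ by positivity), abs_of_pos (show 0 < a * b by positivity),
    abs_of_pos ha0, abs_of_pos hb0, abs_of_pos hw']
  have key : 1 + U ^ 2 / 2 + (M / 2) * (4 * Z + U) + (1 + Z) ≤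
      5 * ((1 + Z) * ((1 + U) ^ 4 * (1 + M))) := by
    rw [← sub_nonneg]
    have h2 : 5 * ((1 + Z) * ((1 + U) ^ 4 * (1 + M))) -
        (1 + U ^ 2 / 2 + (M / 2) * (4 * Z + U) + (1 + Z)) =
        3 + 4 * Z + 5 * M + 3 * Z * M + 20 * U + 59 / 2 * U ^ 2 + 20 * U ^ 3 + 5 * U ^ 4 +
        M * (39 / 2 * U + 30 * U ^ 2 + 20 * U ^ 3 + 5 * U ^ 4) +
        5 * Z * (1 + M) * (4 * U + 6 * U ^ 2 + 4 * U ^ 3 + U ^ 4) := by ring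
    rw [h2]
    positivity
  calc _ = 2 * B₀ * π ^ (-(3 / 2) : ℝ) * (a * b * (U ^ 2)⁻¹) *
        ((1 + U ^ 2 / 2 + (M / 2) * (4 * Z + U)) * J + (1 + Z) * C) := by
        field_simp
        ring
    _ ≤ 2 * B₀ * π ^ (-(3 / 2) : ℝ) * (a * b * (U ^ 2)⁻¹) *
        ((1 + U ^ 2 / 2 + (M / 2) * (4 * Z + U)) * C + (1 + Z) * C) := by gcongr
    _ = 2 * B₀ * π ^ (-(3 / 2) : ℝ) * (a * b * (U ^ 2)⁻¹) * C *
        (1 + U ^ 2 / 2 + (M / 2) * (4 * Z + U) + (1 + Z)) := by ring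
    _ ≤ 2 * B₀ * π ^ (-(3 / 2) : ℝ) * (a * b * (U ^ 2)⁻¹) * C *
        (5 * ((1 + Z) * ((1 + U) ^ 4 * (1 + M)))) := by gcongr
    _ = _ := by ring

theorem slopeLE_lossShift {B₀ γ : ℝ} (hB₀ : 0 < B₀) (hγ₀ : 0 ≤ γ) (hγ₁ : γ ≤ 1)
    (ζ w : R3) (hw : w ≠ 0) :
    SlopeLE (lossShift B₀ γ ζ) w (2 * π * B₀ * π ^ (-(3 / 2) : ℝ) *
      ((1 + ‖ζ‖) * (‖w‖ ^ 2)⁻¹ * ((1 + ‖w‖) ^ 4 * (1 + |energyGap ζ w|) *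
        exp (-(1 / 4) * (‖w‖ ^ 2 + energyGap ζ w ^ 2))))) := by
  have hw' : 0 < ‖w‖ := norm_pos_iff.2 hw
  have s0 : SlopeLE (fun q : R3 => ‖q‖ ^ γ) w (1 + ‖w‖⁻¹) := by
    refine (SlopeLE.comp_hasDerivAt (hasDerivAt_rpow_const (Or.inl hw'.ne'))
      (slopeLE_norm w)).mono ?_
    have h1 := rpow_sub_one_le hw'.le hγ₀ hγ₁
    have h2 : 0 ≤ ‖w‖ ^ (γ - 1) := by positivity
    rw [abs_of_nonneg (by positivity), mul_one]
    nlinarith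
  have s1 : SlopeLE (fun q : R3 => ‖ζ + q‖) w 1 :=
    SlopeLE.of_bound (A := fun _ => 1) continuousAt_const le_rfl <| Eventually.of_forall fun q => by
      rw [one_mul, dist_eq_norm]
      simpa using abs_norm_sub_norm_le (ζ + q) (ζ + w)
  have hd : HasDerivAt (fun x : ℝ => exp (-(1 / 2) * (‖ζ‖ ^ 2 + x ^ 2)))
      (exp (-(1 / 2) * (‖ζ‖ ^ 2 + ‖ζ + w‖ ^ 2)) * (-(1 / 2) * (2 * ‖ζ + w‖))) ‖ζ + w‖ := by
    have := (((hasDerivAt_pow 2 ‖ζ + w‖).const_add (‖ζ‖ ^ 2)).const_mul (-(1 / 2) : ℝ)).exp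
    simpa using this
  have s2 := SlopeLE.comp_hasDerivAt (g := fun q : R3 => ‖ζ + q‖) (p := w) hd s1
  refine ((s0.mul s2).const_mul (π * B₀ * π ^ (-(3 / 2) : ℝ))).mono ?_
  have he : exp (-(1 / 2) * (‖ζ‖ ^ 2 + ‖ζ + w‖ ^ 2)) ≤
      exp (-(1 / 4) * (‖w‖ ^ 2 + energyGap ζ w ^ 2)) :=
    exp_le_exp.2 (by linarith [sq_add_energyGap_sq_le ζ w])
  have h1 : |exp (-(1 / 2) * (‖ζ‖ ^ 2 + ‖ζ + w‖ ^ 2)) * (-(1 / 2) * (2 * ‖ζ + w‖))| =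
      exp (-(1 / 2) * (‖ζ‖ ^ 2 + ‖ζ + w‖ ^ 2)) * ‖ζ + w‖ := by
    rw [abs_mul, abs_of_pos (exp_pos _), show -(1 / 2) * (2 * ‖ζ + w‖) = -‖ζ + w‖ by ring,
      abs_neg, abs_norm]
  have h2 : ‖w‖ ^ γ ≤ 1 + ‖w‖ := rpow_le_one_add hw'.le hγ₀ hγ₁
  have h3 : ‖ζ + w‖ ≤ ‖ζ‖ + ‖w‖ := norm_add_le _ _
  rw [h1, abs_of_pos (exp_pos _), abs_of_nonneg (show 0 ≤ ‖w‖ ^ γ by positivity), mul_one,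
    abs_of_pos (show 0 < π * B₀ * π ^ (-(3 / 2) : ℝ) by positivity)]
  set e := exp (-(1 / 2) * (‖ζ‖ ^ 2 + ‖ζ + w‖ ^ 2))
  set E := exp (-(1 / 4) * (‖w‖ ^ 2 + energyGap ζ w ^ 2))
  have he0 : 0 < e := exp_pos _
  have hE0 : 0 < E := exp_pos _
  set M := |energyGap ζ w|
  have hM : 0 ≤ M := abs_nonneg _
  set U := ‖w‖
  set Z := ‖ζ‖
  have hZ : 0 ≤ Z := norm_nonneg _
  have key : U ^ 2 + U + (1 + U) * (Z + U) * U ^ 2 ≤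
      2 * ((1 + Z) * ((1 + U) ^ 4 * (1 + M))) := by
    have h2 : 2 * ((1 + Z) * ((1 + U) ^ 4 * (1 + M))) - (U ^ 2 + U + (1 + U) * (Z + U) * U ^ 2) =
        2 + 7 * U + 11 * U ^ 2 + 7 * U ^ 3 + U ^ 4 +
        Z * (2 + 8 * U + 11 * U ^ 2 + 7 * U ^ 3 + 2 * U ^ 4) +
        2 * M * ((1 + Z) * (1 + U) ^ 4) := by ring
    rw [← sub_nonneg, h2]
    positivity
  calc _ ≤ π * B₀ * π ^ (-(3 / 2) : ℝ) * ((1 + U⁻¹) * E + (1 + U) * (E * (Z + U))) := by gcongr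
    _ = π * B₀ * π ^ (-(3 / 2) : ℝ) * (E * (U ^ 2)⁻¹) *
        (U ^ 2 + U + (1 + U) * (Z + U) * U ^ 2) := by
        field_simp
    _ ≤ π * B₀ * π ^ (-(3 / 2) : ℝ) * (E * (U ^ 2)⁻¹) *
        (2 * ((1 + Z) * ((1 + U) ^ 4 * (1 + M)))) := by gcongr
    _ = _ := by ring

/-- The surplus `1/4 - β` in the exponent absorbs the polynomial. The gradient bounds carry only the
fourth power of `1 + U`; the fifth is reserved for exchanging `1 + ‖ζ‖` with `1 + ‖ζs‖`. -/
theorem exists_poly_mul_exp_le {β : ℝ} (hβ : β < 1 / 4) :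
    ∃ C : ℝ, 0 < C ∧ ∀ U m : ℝ, 0 ≤ U →
      (1 + U) ^ 5 * (1 + |m|) * exp (-(1 / 4) * (U ^ 2 + m ^ 2)) ≤
        C * exp (-β * (U ^ 2 + m ^ 2)) := by
  obtain ⟨C₁, h1, H1⟩ := exists_one_add_pow_mul_exp_le 5 (sub_pos.2 hβ)
  obtain ⟨C₂, h2, H2⟩ := exists_one_add_pow_mul_exp_le 1 (sub_pos.2 hβ)
  refine ⟨C₁ * C₂, by positivity, fun U m hU => ?_⟩
  have a1 := H1 U hU
  have a2 := H2 |m| (abs_nonneg m)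
  rw [pow_one, sq_abs] at a2
  have e : exp (-(1 / 4) * (U ^ 2 + m ^ 2)) = exp (-(1 / 4 - β) * U ^ 2) *
      exp (-(1 / 4 - β) * m ^ 2) * exp (-β * (U ^ 2 + m ^ 2)) := by
    rw [← exp_add, ← exp_add]; ring_nf
  rw [e]
  calc _ = ((1 + U) ^ 5 * exp (-(1 / 4 - β) * U ^ 2)) * ((1 + |m|) * exp (-(1 / 4 - β) * m ^ 2)) *
        exp (-β * (U ^ 2 + m ^ 2)) := by ring
    _ ≤ C₁ * C₂ * exp (-β * (U ^ 2 + m ^ 2)) := by gcongr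

/-- Pointwise bounds for the kernel of `K` and for its velocity gradient. -/
theorem exists_kernelK_bounds {B₀ γ β : ℝ} (hB₀ : 0 < B₀) (hγ₀ : 0 ≤ γ) (hγ₁ : γ ≤ 1)
    (hβ : β < 1 / 4) :
    ∃ A : ℝ, 0 < A ∧ ∀ ζ ζs : R3, ζs ≠ ζ →
      |kernelK B₀ γ ζ ζs| ≤ A * kernelWeight β ζ ζs ∧
      SlopeLE (kernelK B₀ γ ζ) ζs (A * (1 + ‖ζ‖) * kernelWeight β ζ ζs) ∧
      SlopeLE (kernelK B₀ γ ζ) ζs (A * (1 + ‖ζs‖) * kernelWeight β ζ ζs) := by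
  obtain ⟨C, hC0, hJ, hC⟩ := exists_planeIntegral_le hγ₀ hγ₁
  obtain ⟨P, hP0, hP⟩ := exists_poly_mul_exp_le hβ
  set m : ℝ := π ^ (-(3 / 2) : ℝ) with hm
  have hm0 : 0 < m := by positivity
  set A₁ := 10 * B₀ * m * C + 2 * π * B₀ * m with hA1
  have hA0 : 0 < A₁ := by positivity
  refine ⟨A₁ * P, by positivity, fun ζ ζs hne => ?_⟩
  set w := ζs - ζ with hwdef
  have hw : w ≠ 0 := sub_ne_zero.2 hne
  have hw' : 0 < ‖w‖ := norm_pos_iff.2 hw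
  have hW : kernelWeight β ζ ζs =
      (‖w‖ ^ 2)⁻¹ * exp (-β * (‖w‖ ^ 2 + energyGap ζ w ^ 2)) := by
    rw [kernelWeight, energyGap_sq]
  have hP' := hP ‖w‖ (energyGap ζ w) hw'.le
  have hp4 : (1 + ‖w‖) ^ 4 * (1 + |energyGap ζ w|) *
      exp (-(1 / 4) * (‖w‖ ^ 2 + energyGap ζ w ^ 2)) ≤
      (1 + ‖w‖) ^ 5 * (1 + |energyGap ζ w|) *
      exp (-(1 / 4) * (‖w‖ ^ 2 + energyGap ζ w ^ 2)) := by
    gcongr <;> linarith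
  have hslope : SlopeLE (kernelK B₀ γ ζ) ζs (A₁ *
      ((1 + ‖ζ‖) * (‖w‖ ^ 2)⁻¹ * ((1 + ‖w‖) ^ 4 * (1 + |energyGap ζ w|) *
        exp (-(1 / 4) * (‖w‖ ^ 2 + energyGap ζ w ^ 2))))) := by
    have := (slopeLE_gainShift hB₀ hC0 hJ hC ζ w hw).sub (slopeLE_lossShift hB₀ hγ₀ hγ₁ ζ w hw)
    rw [← add_mul] at this
    have h2 := this.comp_sub_const
    have e : kernelK B₀ γ ζ = fun q => gainShift B₀ γ ζ (q - ζ) - lossShift B₀ γ ζ (q - ζ) :=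
      funext fun q => kernelK_eq B₀ γ ζ q
    rw [e]
    exact h2
  refine ⟨?_, hslope.mono ?_, hslope.mono ?_⟩
  · rw [kernelK_eq, ← hwdef]
    obtain ⟨j0, j1⟩ := hJ ‖w‖ (perpLength ζ w)
    have h2 : ‖w‖ ^ γ ≤ 1 + ‖w‖ := rpow_le_one_add hw'.le hγ₀ hγ₁
    have he : exp (-(1 / 2) * (‖ζ‖ ^ 2 + ‖ζ + w‖ ^ 2)) ≤
        exp (-(1 / 4) * (‖w‖ ^ 2 + energyGap ζ w ^ 2)) :=
      exp_le_exp.2 (by linarith [sq_add_energyGap_sq_le ζ w])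
    have g1 : |gainShift B₀ γ ζ w| ≤ 2 * B₀ * m * C *
        (‖w‖⁻¹ * exp (-(1 / 4) * (‖w‖ ^ 2 + energyGap ζ w ^ 2))) := by
      rw [gainShift, ← hm, abs_of_nonneg (by positivity), mul_add (-(1 / 4) : ℝ), exp_add]
      calc _ ≤ 2 * B₀ * m * (‖w‖⁻¹ * (exp (-(1 / 4) * ‖w‖ ^ 2) *
            exp (-(1 / 4) * energyGap ζ w ^ 2)) * C) := by gcongr
        _ = _ := by ring
    have g2 : |lossShift B₀ γ ζ w| ≤ π * B₀ * m * ((1 + ‖w‖) *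
        exp (-(1 / 4) * (‖w‖ ^ 2 + energyGap ζ w ^ 2))) := by
      rw [lossShift, ← hm, abs_of_nonneg (by positivity)]
      gcongr
    set E := exp (-(1 / 4) * (‖w‖ ^ 2 + energyGap ζ w ^ 2))
    have hE : 0 < E := exp_pos _
    set M := |energyGap ζ w|
    have hM : 0 ≤ M := abs_nonneg _
    set U := ‖w‖
    -- The kernel itself is less singular than `|w|⁻²`; weakening its bound lets one weight serve
    -- both the kernel and its gradient.
    have k1 : U⁻¹ ≤ (U ^ 2)⁻¹ * ((1 + U) ^ 5 * (1 + M)) := by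
      rw [← div_eq_inv_mul, le_div_iff₀ (by positivity)]
      have e1 : U⁻¹ * U ^ 2 = U := by field_simp
      have e2 : (1 + U) ^ 5 * (1 + M) - U = (1 + U) ^ 5 * M +
        (1 + 4 * U + 10 * U ^ 2 + 10 * U ^ 3 + 5 * U ^ 4 + U ^ 5) := by ring
      rw [e1, ← sub_nonneg, e2]
      positivity
    have k2 : (1 + U) ≤ (U ^ 2)⁻¹ * ((1 + U) ^ 5 * (1 + M)) := by
      rw [← div_eq_inv_mul, le_div_iff₀ (by positivity)]
      have e2 : (1 + U) ^ 5 * (1 + M) - (1 + U) * U ^ 2 = (1 + U) ^ 5 * M +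
        (1 + 5 * U + 9 * U ^ 2 + 9 * U ^ 3 + 5 * U ^ 4 + U ^ 5) := by ring
      rw [← sub_nonneg, e2]
      positivity
    calc _ ≤ |gainShift B₀ γ ζ w| + |lossShift B₀ γ ζ w| := abs_sub _ _
      _ ≤ 2 * B₀ * m * C * ((U ^ 2)⁻¹ * ((1 + U) ^ 5 * (1 + M)) * E) +
          π * B₀ * m * ((U ^ 2)⁻¹ * ((1 + U) ^ 5 * (1 + M)) * E) := by
          refine add_le_add (g1.trans ?_) (g2.trans ?_) <;> gcongr
      _ = (2 * B₀ * m * C + π * B₀ * m) * ((U ^ 2)⁻¹ * ((1 + U) ^ 5 * (1 + M) * E)) := by ring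
      _ ≤ A₁ * ((U ^ 2)⁻¹ * (P * exp (-β * (U ^ 2 + energyGap ζ w ^ 2)))) := by
          have : 2 * B₀ * m * C + π * B₀ * m ≤ A₁ := by
            have p1 : 0 < B₀ * m * C := by positivity
            have p2 : 0 < π * B₀ * m := by positivity
            rw [hA1]
            linarith
          gcongr
      _ = _ := by rw [hW]; ring
  · calc _ ≤ A₁ * ((1 + ‖ζ‖) * (‖w‖ ^ 2)⁻¹ * (P * exp (-β * (‖w‖ ^ 2 + energyGap ζ w ^ 2)))) := by
          refine mul_le_mul_of_nonneg_left ?_ hA0.le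
          exact mul_le_mul_of_nonneg_left (hp4.trans hP') (by positivity)
      _ = _ := by rw [hW]; ring
  · have hZ : 1 + ‖ζ‖ ≤ (1 + ‖ζs‖) * (1 + ‖w‖) := by
      have h1 : ‖ζ‖ ≤ ‖ζs‖ + ‖w‖ := by
        have := norm_sub_le ζs w
        rwa [hwdef, sub_sub_cancel] at this
      nlinarith [mul_nonneg (norm_nonneg ζs) (norm_nonneg w)]
    calc _ ≤ A₁ * (((1 + ‖ζs‖) * (1 + ‖w‖)) * (‖w‖ ^ 2)⁻¹ *
          ((1 + ‖w‖) ^ 4 * (1 + |energyGap ζ w|) *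
            exp (-(1 / 4) * (‖w‖ ^ 2 + energyGap ζ w ^ 2)))) := by gcongr
      _ = A₁ * ((1 + ‖ζs‖) * (‖w‖ ^ 2)⁻¹ * ((1 + ‖w‖) ^ 5 * (1 + |energyGap ζ w|) *
            exp (-(1 / 4) * (‖w‖ ^ 2 + energyGap ζ w ^ 2)))) := by ring
      _ ≤ A₁ * ((1 + ‖ζs‖) * (‖w‖ ^ 2)⁻¹ *
            (P * exp (-β * (‖w‖ ^ 2 + energyGap ζ w ^ 2)))) := by gcongr
      _ = _ := by rw [hW]; ring

/-! ### Weighted `L¹` bounds for the kernel weight. -/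

/-- Since `|ζ + w|² = |ζ|² - m|w|`, moving the Gaussian weight from `ζ + w` to `ζ` costs `αm|w| ≤
(α/2)(|w|² + m²)`, which leaves the rate `δ = β - α/2`. With `t = ζ·w/|w|` one has `m² = (2t +
|w|)²`, hence `t² ≤ |w|²/2 + m²`. The remaining decay therefore contains `e^{-δt²} ≤ (1 + δt²)⁻¹`,
which merges with `|w|⁻²` into the rational factor. -/
theorem kernelWeight_mul_exp_le {α β : ℝ} (hα₀ : 0 ≤ α) (hβ : α / 2 < β) (ζ w : R3) (hw : w ≠ 0) :
    kernelWeight β ζ (ζ + w) * exp (-α * ‖ζ + w‖ ^ 2) ≤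
      exp (-α * ‖ζ‖ ^ 2) * (exp (-((β - α / 2) / 2) * ‖w‖ ^ 2) *
        (‖w‖ ^ 2 + (β - α / 2) * (inner ℝ ζ w) ^ 2)⁻¹) := by
  have hw' : 0 < ‖w‖ := norm_pos_iff.2 hw
  set δ := β - α / 2 with hδ
  have hδ0 : 0 < δ := by rw [hδ]; linarith
  have hgap := energyGap_sq ζ (ζ + w)
  rw [add_sub_cancel_left] at hgap
  set m := (‖ζ‖ ^ 2 - ‖ζ + w‖ ^ 2) / ‖w‖ with hm
  set t := inner ℝ ζ (‖w‖⁻¹ • w) with ht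
  have hmU : ‖ζ + w‖ ^ 2 = ‖ζ‖ ^ 2 - m * ‖w‖ := by rw [hm]; field_simp; ring
  have hin : inner ℝ ζ w = t * ‖w‖ := by rw [ht, inner_smul_right]; field_simp
  have hm2 : t ^ 2 ≤ ‖w‖ ^ 2 / 2 + m ^ 2 := by
    rw [← hgap, energyGap, ← ht]
    nlinarith [sq_nonneg (3 * ‖w‖ + 4 * t), sq_nonneg t]
  have hx : exp (-(δ * t ^ 2)) ≤ (1 + δ * t ^ 2)⁻¹ := by
    rw [exp_neg]
    have := add_one_le_exp (δ * t ^ 2)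
    have h0 : 0 ≤ δ * t ^ 2 := by positivity
    gcongr
    linarith
  have hexp : exp (-β * (‖w‖ ^ 2 + m ^ 2)) * exp (-α * ‖ζ + w‖ ^ 2) ≤
      exp (-α * ‖ζ‖ ^ 2) * exp (-(δ / 2) * ‖w‖ ^ 2) * exp (-(δ * t ^ 2)) := by
    rw [← exp_add, ← exp_add, ← exp_add, hmU]
    refine exp_le_exp.2 ?_
    have h1 : β = δ + α / 2 := by rw [hδ]; ring
    rw [h1]
    nlinarith [mul_nonneg hα₀ (sq_nonneg (‖w‖ - m)), mul_le_mul_of_nonneg_left hm2 hδ0.le]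
  rw [kernelWeight, add_sub_cancel_left, ← hm, hin]
  calc _ = (‖w‖ ^ 2)⁻¹ * (exp (-β * (‖w‖ ^ 2 + m ^ 2)) * exp (-α * ‖ζ + w‖ ^ 2)) := by ring
    _ ≤ (‖w‖ ^ 2)⁻¹ *
        (exp (-α * ‖ζ‖ ^ 2) * exp (-(δ / 2) * ‖w‖ ^ 2) * (1 + δ * t ^ 2)⁻¹) := by
        refine mul_le_mul_of_nonneg_left (hexp.trans ?_) (by positivity)
        gcongr
    _ = _ := by
        rw [show ‖w‖ ^ 2 + δ * (t * ‖w‖) ^ 2 = ‖w‖ ^ 2 * (1 + δ * t ^ 2) by ring, mul_inv]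
        ring

theorem measurable_comp_pair {X Y Z W : Type*} [MeasurableSpace X] [MeasurableSpace Y]
    [MeasurableSpace Z] [MeasurableSpace W] {k : Y → Z → W}
    (hk : Measurable (fun p : Y × Z => k p.1 p.2)) {u : X → Y} {v : X → Z} (hu : Measurable u)
    (hv : Measurable v) : Measurable (fun x => k (u x) (v x)) :=
  hk.comp (hu.prodMk hv)

theorem measurable_kernelWeight (β : ℝ) :
    Measurable (fun p : R3 × R3 => kernelWeight β p.1 p.2) := by
  unfold kernelWeight; fun_prop

theorem continuousAt_kernelWeight (β : ℝ) {ζ ζs : R3} (h : ζs ≠ ζ) :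
    ContinuousAt (kernelWeight β ζ) ζs := by
  have hw : ‖ζs - ζ‖ ≠ 0 := norm_ne_zero_iff.2 (sub_ne_zero.2 h)
  unfold kernelWeight
  refine ContinuousAt.mul (ContinuousAt.inv₀ (by fun_prop) (by positivity)) ?_
  have : ContinuousAt (fun x : R3 => (‖ζ‖ ^ 2 - ‖x‖ ^ 2) / ‖x - ζ‖) ζs :=
    ContinuousAt.div₀ (by fun_prop) (by fun_prop) hw
  fun_prop

/-- The weighted `L¹` bound for the kernel of `K` and for its velocity gradient. -/
theorem exists_lintegral_kernelWeight_le {α β : ℝ} (hα₀ : 0 ≤ α) (hβ : α / 2 < β) :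
    ∃ C : ℝ, 0 < C ∧ ∀ ζ : R3,
      ∫⁻ ζs : R3, ENNReal.ofReal ((1 + ‖ζ‖) * kernelWeight β ζ ζs * exp (-α * ‖ζs‖ ^ 2)) ≤
        ENNReal.ofReal (C * exp (-α * ‖ζ‖ ^ 2)) := by
  have hδ0 : 0 < β - α / 2 := by linarith
  obtain ⟨C, hC0, hC⟩ := exists_lintegral_exp_div_le (half_pos hδ0) hδ0
  refine ⟨C, hC0, fun ζ => ?_⟩
  have hZ : 0 < 1 + ‖ζ‖ := by positivity
  rw [← lintegral_add_left_eq_self _ ζ]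
  calc _ ≤ ∫⁻ w : R3, ENNReal.ofReal ((1 + ‖ζ‖) * exp (-α * ‖ζ‖ ^ 2)) *
        ENNReal.ofReal (exp (-((β - α / 2) / 2) * ‖w‖ ^ 2) *
        (‖w‖ ^ 2 + (β - α / 2) * (inner ℝ ζ w) ^ 2)⁻¹) := by
        refine lintegral_mono_ae ?_
        filter_upwards [compl_mem_ae_iff.2 (measure_singleton (0 : R3))] with w hw
        rw [← ENNReal.ofReal_mul (by positivity)]
        apply ENNReal.ofReal_le_ofReal
        rw [mul_assoc, mul_assoc]
        exact mul_le_mul_of_nonneg_left (kernelWeight_mul_exp_le hα₀ hβ ζ w hw) hZ.le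
    _ = ENNReal.ofReal ((1 + ‖ζ‖) * exp (-α * ‖ζ‖ ^ 2)) * ∫⁻ w : R3,
        ENNReal.ofReal (exp (-((β - α / 2) / 2) * ‖w‖ ^ 2) *
        (‖w‖ ^ 2 + (β - α / 2) * (inner ℝ ζ w) ^ 2)⁻¹) :=
        lintegral_const_mul _ (by fun_prop)
    _ ≤ ENNReal.ofReal ((1 + ‖ζ‖) * exp (-α * ‖ζ‖ ^ 2)) * ENNReal.ofReal (C * (1 + ‖ζ‖)⁻¹) := by
        gcongr
        exact hC ζ
    _ = _ := by
        rw [← ENNReal.ofReal_mul (by positivity)]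
        congr 1
        field_simp

/-! ### The kernel of `K e^{-νs} K` under translations of the intermediate velocity. -/

/-- The exceptional `q` lie in an affine subspace of dimension at most one through `ζ`, a null set.
Almost every segment of direction `a` thus avoids the singularities of the kernel. -/
theorem ae_forall_add_smul_ne (ζ a : R3) : ∀ᵐ q : R3, ∀ t : ℝ, q + t • a ≠ ζ := by
  have hne : (AffineSubspace.mk' ζ (ℝ ∙ a)) ≠ ⊤ := by
    intro h
    have h1 : (ℝ ∙ a) = ⊤ := by
      rw [← AffineSubspace.direction_mk' ζ (ℝ ∙ a), h, AffineSubspace.direction_top]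
    have h2 : Module.finrank ℝ (ℝ ∙ a) ≤ 1 :=
      (finrank_span_le_card ({a} : Set R3)).trans (by simp)
    rw [h1, finrank_top] at h2
    simp at h2
  have h0 := Measure.addHaar_affineSubspace (volume : Measure R3) _ hne
  filter_upwards [compl_mem_ae_iff.2 h0] with q hq t ht
  apply hq
  rw [SetLike.mem_coe, AffineSubspace.mem_mk', vsub_eq_sub, ← ht, Submodule.mem_span_singleton]
  exact ⟨-t, by module⟩

/-- The `L¹` modulus of continuity under translations of a function that is locally Lipschitz off
two points. -/
theorem lintegral_enorm_translate_sub_le {g D : R3 → ℝ} {ζ η : R3} (a : R3) (hD0 : ∀ q, 0 ≤ D q)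
    (hDm : Measurable D) (hg : ∀ q, q ≠ ζ → q ≠ η → SlopeLE g q (D q))
    (hDc : ∀ q, q ≠ ζ → q ≠ η → ContinuousAt D q) :
    ∫⁻ q, ‖g (q + a) - g q‖ₑ ≤ ‖a‖ₑ * ∫⁻ q, ENNReal.ofReal (D q) := by
  have hDm2 : Measurable (fun p : R3 × ℝ => ENNReal.ofReal (D (p.1 + p.2 • a))) := by
    have : Measurable (fun p : R3 × ℝ => p.1 + p.2 • a) := by fun_prop
    exact (hDm.comp this).ennreal_ofReal
  calc _ ≤ ∫⁻ q, ‖a‖ₑ * ∫⁻ t in Ioc (0 : ℝ) 1, ENNReal.ofReal (D (q + t • a)) := by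
        refine lintegral_mono_ae ?_
        filter_upwards [ae_forall_add_smul_ne ζ a, ae_forall_add_smul_ne η a] with q h1 h2
        have hc : ∀ t ∈ Icc (0 : ℝ) 1, ContinuousAt D (q + t • a) := fun t _ =>
          hDc _ (h1 t) (h2 t)
        have h3 := abs_sub_le_norm_mul_integral (g := g) (p := q) (a := a)
          (fun t _ => hg _ (h1 t) (h2 t)) hc
        have hcont : ContinuousOn (fun t : ℝ => D (q + t • a)) (Icc 0 1) := by
          intro t ht
          have h4 : ContinuousAt (fun s : ℝ => q + s • a) t := by fun_prop
          exact (ContinuousAt.comp (f := fun s : ℝ => q + s • a) (hc t ht) h4).continuousWithinAt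
        have hint : IntegrableOn (fun t : ℝ => D (q + t • a)) (Ioc 0 1) :=
          hcont.integrableOn_Icc.mono_set Ioc_subset_Icc_self
        rw [← ofReal_integral_eq_lintegral_ofReal hint (Eventually.of_forall fun t => hD0 _),
          ← intervalIntegral.integral_of_le zero_le_one, ← ofReal_norm, ← ofReal_norm,
          ← ENNReal.ofReal_mul (norm_nonneg _)]
        exact ENNReal.ofReal_le_ofReal h3
    _ = ‖a‖ₑ * ∫⁻ q, ∫⁻ t in Ioc (0 : ℝ) 1, ENNReal.ofReal (D (q + t • a)) :=
        lintegral_const_mul _ hDm2.lintegral_prod_right'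
    _ = ‖a‖ₑ * ∫⁻ t in Ioc (0 : ℝ) 1, ∫⁻ q, ENNReal.ofReal (D (q + t • a)) := by
        rw [lintegral_lintegral_swap hDm2.aemeasurable]
    _ = ‖a‖ₑ * ∫⁻ q, ENNReal.ofReal (D q) := by
        have : ∀ t : ℝ, ∫⁻ q, ENNReal.ofReal (D (q + t • a)) = ∫⁻ q, ENNReal.ofReal (D q) :=
          fun t => lintegral_add_right_eq_self (fun q => ENNReal.ofReal (D q)) (t • a)
        simp [this]

/-- The kernel of `K e^{-ν s} K`. -/
noncomputable def doubleKernel (B₀ γ s : ℝ) (ζ q η : R3) : ℝ :=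
  kernelK B₀ γ ζ q * kernelK B₀ γ q η * exp (-nu B₀ γ q * s)

theorem measurable_doubleKernel {B₀ γ : ℝ} (hB₀ : 0 < B₀) (hγ₀ : 0 ≤ γ) (hγ₁ : γ ≤ 1) (s : ℝ)
    (ζ : R3) : Measurable (fun p : R3 × R3 => doubleKernel B₀ γ s ζ p.1 p.2) := by
  have hν := (continuous_nu hB₀ hγ₀ hγ₁).measurable
  have h1 : Measurable (fun p : R3 × R3 => kernelK B₀ γ ζ p.1) :=
    measurable_comp_pair (measurable_kernelK B₀ γ) measurable_const measurable_fst
  exact (h1.mul (measurable_kernelK B₀ γ)).mul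
    (((hν.comp measurable_fst).neg.mul_const s).exp)

theorem measurable_weight_mul_weight (β : ℝ) (ζ : R3) :
    Measurable (fun p : R3 × R3 => (1 + ‖ζ‖) * kernelWeight β ζ p.1 *
      ((1 + ‖p.1‖) * kernelWeight β p.1 p.2)) := by
  have h1 : Measurable (fun p : R3 × R3 => kernelWeight β ζ p.1) :=
    measurable_comp_pair (measurable_kernelWeight β) measurable_const measurable_fst
  exact (h1.const_mul _).mul ((measurable_fst.norm.const_add _).mul (measurable_kernelWeight β))

theorem measurable_weight_mul_weight_gaussian (α β : ℝ) (ζ : R3) :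
    Measurable (fun p : R3 × R3 => ((1 + ‖ζ‖) * kernelWeight β ζ p.1 *
      ((1 + ‖p.1‖) * kernelWeight β p.1 p.2)) * exp (-α * ‖p.2‖ ^ 2)) := by
  have h1 : Measurable (fun p : R3 × R3 => exp (-α * ‖p.2‖ ^ 2)) := by fun_prop
  exact (measurable_weight_mul_weight β ζ).mul h1

theorem measurable_gaussian_snd (α : ℝ) :
    Measurable (fun p : R3 × R3 => exp (-α * ‖p.2‖ ^ 2)) := by
  fun_prop

/-- The `η`-integral, using the factor `1 + ‖q‖`, reproduces the Gaussian weight at `q`; the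
`q`-integral, using `1 + ‖ζ‖`, then carries it to `ζ`. -/
theorem exists_lintegral_weight_mul_weight_le {α β : ℝ} (hα₀ : 0 ≤ α) (hβ : α / 2 < β) :
    ∃ C : ℝ, 0 < C ∧ ∀ ζ : R3,
      ∫⁻ p : R3 × R3, ENNReal.ofReal (((1 + ‖ζ‖) * kernelWeight β ζ p.1 *
        ((1 + ‖p.1‖) * kernelWeight β p.1 p.2)) * exp (-α * ‖p.2‖ ^ 2)) ≤
        ENNReal.ofReal (C * exp (-α * ‖ζ‖ ^ 2)) := by
  obtain ⟨C, hC0, hC⟩ := exists_lintegral_kernelWeight_le hα₀ hβ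
  refine ⟨C * C, by positivity, fun ζ => ?_⟩
  have hm2 := measurable_kernelWeight β
  have hm1 : Measurable (fun q : R3 => kernelWeight β ζ q) :=
    measurable_comp_pair hm2 measurable_const measurable_id
  rw [Measure.volume_eq_prod, lintegral_prod _ (measurable_weight_mul_weight_gaussian α β
    ζ).ennreal_ofReal.aemeasurable]
  have hW := kernelWeight_nonneg β
  calc _ ≤ ∫⁻ q : R3, ENNReal.ofReal ((1 + ‖ζ‖) * kernelWeight β ζ q) *
        ENNReal.ofReal (C * exp (-α * ‖q‖ ^ 2)) := by
        refine lintegral_mono fun q => ?_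
        have hnn : 0 ≤ (1 + ‖ζ‖) * kernelWeight β ζ q := mul_nonneg (by positivity) (hW _ _)
        refine le_trans (le_of_eq ?_) (mul_le_mul_right (hC q) _)
        rw [← lintegral_const_mul]
        · refine lintegral_congr fun η => ?_
          rw [← ENNReal.ofReal_mul hnn]
          congr 1
          ring
        · have : Measurable (fun η : R3 => kernelWeight β q η) :=
            measurable_comp_pair hm2 measurable_const measurable_id
          have h4 : Measurable (fun η : R3 => exp (-α * ‖η‖ ^ 2)) := by fun_prop
          exact ((this.const_mul _).mul h4).ennreal_ofReal
    _ = ENNReal.ofReal C * ∫⁻ q : R3,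
        ENNReal.ofReal ((1 + ‖ζ‖) * kernelWeight β ζ q * exp (-α * ‖q‖ ^ 2)) := by
        have h4 : Measurable (fun q : R3 => exp (-α * ‖q‖ ^ 2)) := by fun_prop
        have h5 : Measurable (fun q : R3 => ENNReal.ofReal ((1 + ‖ζ‖) * kernelWeight β ζ q *
            exp (-α * ‖q‖ ^ 2))) := ((hm1.const_mul _).mul h4).ennreal_ofReal
        rw [← lintegral_const_mul _ h5]
        refine lintegral_congr fun q => ?_
        have hnn : 0 ≤ (1 + ‖ζ‖) * kernelWeight β ζ q := mul_nonneg (by positivity) (hW _ _)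
        rw [← ENNReal.ofReal_mul hnn, ← ENNReal.ofReal_mul hC0.le]
        congr 1
        ring
    _ ≤ ENNReal.ofReal C * ENNReal.ofReal (C * exp (-α * ‖ζ‖ ^ 2)) := by
        gcongr
        exact hC ζ
    _ = _ := by
        rw [← ENNReal.ofReal_mul hC0.le]
        congr 1
        ring

/-- The kernel of `K e^{-ν s} K` is bounded in a weighted `L¹` space and Lipschitz there under
translations of the intermediate velocity. -/
theorem exists_lintegral_doubleKernel_le {B₀ γ α : ℝ} (hB₀ : 0 < B₀) (hγ₀ : 0 ≤ γ) (hγ₁ : γ ≤ 1)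
    (hα₀ : 0 ≤ α) (hα₁ : α < 1 / 2) :
    ∃ κ C : ℝ, 0 < κ ∧ 0 < C ∧ ∀ (ζ : R3) (s : ℝ), 0 ≤ s →
      ∫⁻ p : R3 × R3, ‖doubleKernel B₀ γ s ζ p.1 p.2‖ₑ * ENNReal.ofReal (exp (-α * ‖p.2‖ ^ 2)) ≤
        ENNReal.ofReal (C * exp (-κ * s) * exp (-α * ‖ζ‖ ^ 2)) ∧
      ∀ a : R3, ∫⁻ p : R3 × R3,
        ‖doubleKernel B₀ γ s ζ (p.1 + a) p.2 - doubleKernel B₀ γ s ζ p.1 p.2‖ₑ *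
          ENNReal.ofReal (exp (-α * ‖p.2‖ ^ 2)) ≤
        ENNReal.ofReal (C * ‖a‖ * exp (-κ * s) * exp (-α * ‖ζ‖ ^ 2)) := by
  obtain ⟨β, hβ1, hβ2⟩ := exists_between (show α / 2 < 1 / 4 by linarith)
  obtain ⟨A, hA0, hA⟩ := exists_kernelK_bounds hB₀ hγ₀ hγ₁ hβ2
  obtain ⟨κ, c, hκ, hc1, hc⟩ := exists_slopeLE_exp_nu hB₀ hγ₀ hγ₁
  obtain ⟨C, hC0, hC⟩ := exists_lintegral_weight_mul_weight_le hα₀ hβ1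
  have hc0 : 0 < c := by linarith
  refine ⟨κ, 3 * A * A * c * C, hκ, by positivity, fun ζ s hs => ?_⟩
  -- The factor `3` counts the terms of the product rule (two kernels and the damping factor), each
  -- bounded by the same product of weights.
  set D : R3 → R3 → ℝ := fun q η => (3 * A * A * (c * exp (-κ * s))) *
    ((1 + ‖ζ‖) * kernelWeight β ζ q * ((1 + ‖q‖) * kernelWeight β q η)) with hD
  have hW := kernelWeight_nonneg β
  have hD0 : ∀ q η, 0 ≤ D q η := fun q η => by
    have := hW ζ q
    have := hW q η
    rw [hD]; positivity
  have hDm : Measurable (fun p : R3 × R3 => D p.1 p.2) :=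
    (measurable_weight_mul_weight β ζ).const_mul _
  have hGm : Measurable (fun p : R3 × R3 => ENNReal.ofReal (exp (-α * ‖p.2‖ ^ 2))) :=
    (measurable_gaussian_snd α).ennreal_ofReal
  have hDGm : Measurable (fun p : R3 × R3 => ENNReal.ofReal (D p.1 p.2) *
      ENNReal.ofReal (exp (-α * ‖p.2‖ ^ 2))) := hDm.ennreal_ofReal.mul hGm
  have hDint : ∫⁻ p : R3 × R3, ENNReal.ofReal (D p.1 p.2) *
      ENNReal.ofReal (exp (-α * ‖p.2‖ ^ 2)) ≤
      ENNReal.ofReal (3 * A * A * c * C * exp (-κ * s) * exp (-α * ‖ζ‖ ^ 2)) := by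
    have hk : 0 ≤ 3 * A * A * (c * exp (-κ * s)) := by positivity
    calc _ = ENNReal.ofReal (3 * A * A * (c * exp (-κ * s))) * ∫⁻ p : R3 × R3,
          ENNReal.ofReal (((1 + ‖ζ‖) * kernelWeight β ζ p.1 *
          ((1 + ‖p.1‖) * kernelWeight β p.1 p.2)) * exp (-α * ‖p.2‖ ^ 2)) := by
          rw [← lintegral_const_mul _ (measurable_weight_mul_weight_gaussian α β
            ζ).ennreal_ofReal]
          refine lintegral_congr fun p => ?_
          rw [← ENNReal.ofReal_mul (hD0 _ _), ← ENNReal.ofReal_mul hk, hD]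
          congr 1
          ring
      _ ≤ ENNReal.ofReal (3 * A * A * (c * exp (-κ * s))) *
          ENNReal.ofReal (C * exp (-α * ‖ζ‖ ^ 2)) := by
          gcongr
          exact hC ζ
      _ = _ := by
          rw [← ENNReal.ofReal_mul hk]
          congr 1
          ring
  have hbasic : ∀ q η : R3, q ≠ ζ → q ≠ η →
      |doubleKernel B₀ γ s ζ q η| ≤ D q η ∧
      SlopeLE (fun q => doubleKernel B₀ γ s ζ q η) q (D q η) := by
    intro q η h1 h2
    -- The gradient of the first kernel is taken with the factor `1 + ‖ζ‖`, that of the second,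
    -- after symmetry, with `1 + ‖q‖`: in each case the velocity held fixed in the corresponding
    -- `L¹` bound.
    obtain ⟨a1, a2, -⟩ := hA ζ q h1
    obtain ⟨b1, -, b3⟩ := hA η q h2
    obtain ⟨e1, e2⟩ := hc q s hs
    have hb : (fun q => kernelK B₀ γ q η) = kernelK B₀ γ η := funext fun q => kernelK_symm _ _ _ _
    rw [← hb] at b3
    rw [kernelK_symm, kernelWeight_symm] at b1
    rw [kernelWeight_symm] at b3
    have w1 := hW ζ q
    have w2 := hW q η
    have he : 0 < exp (-nu B₀ γ q * s) := exp_pos _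
    have hce : 0 < c * exp (-κ * s) := by positivity
    set W1 := kernelWeight β ζ q
    set W2 := kernelWeight β q η
    set X := c * exp (-κ * s)
    have hZ : 0 ≤ ‖ζ‖ := norm_nonneg _
    have hQ : 0 ≤ ‖q‖ := norm_nonneg _
    have hww : 0 ≤ W1 * W2 := mul_nonneg w1 w2
    have hm : A * W1 * (A * W2) * X ≤ A * A * X * ((1 + ‖ζ‖) * W1 * ((1 + ‖q‖) * W2)) := by
      have : W1 * W2 ≤ (1 + ‖ζ‖) * W1 * ((1 + ‖q‖) * W2) := by
        rw [← sub_nonneg]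
        have e : (1 + ‖ζ‖) * W1 * ((1 + ‖q‖) * W2) - W1 * W2 =
          (‖ζ‖ + ‖q‖ + ‖ζ‖ * ‖q‖) * (W1 * W2) := by ring
        rw [e]
        positivity
      calc _ = A * A * X * (W1 * W2) := by ring
        _ ≤ _ := by gcongr
    have hprod : 0 ≤ A * A * X * ((1 + ‖ζ‖) * W1 * ((1 + ‖q‖) * W2)) := by positivity
    have hDeq : D q η = 3 * (A * A * X * ((1 + ‖ζ‖) * W1 * ((1 + ‖q‖) * W2))) := by
      rw [hD]; ring
    refine ⟨?_, ?_⟩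
    · rw [doubleKernel, abs_mul, abs_mul, abs_of_pos he, hDeq]
      calc _ ≤ A * W1 * (A * W2) * X := by gcongr
        _ ≤ _ := by linarith
    · refine ((a2.mul b3).mul e2).mono ?_
      rw [abs_mul, abs_of_pos he, hDeq]
      calc _ ≤ (A * (1 + ‖ζ‖) * W1 * (A * W2) + A * W1 * (A * (1 + ‖q‖) * W2)) * X +
            A * W1 * (A * W2) * X := by gcongr
        _ ≤ _ := by
            have h3 : A * (1 + ‖ζ‖) * W1 * (A * W2) * X ≤
                A * A * X * ((1 + ‖ζ‖) * W1 * ((1 + ‖q‖) * W2)) := by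
              have : W2 ≤ (1 + ‖q‖) * W2 := by nlinarith
              calc _ = A * A * X * ((1 + ‖ζ‖) * W1 * W2) := by ring
                _ ≤ _ := by gcongr
            have h4 : A * W1 * (A * (1 + ‖q‖) * W2) * X ≤
                A * A * X * ((1 + ‖ζ‖) * W1 * ((1 + ‖q‖) * W2)) := by
              have : W1 ≤ (1 + ‖ζ‖) * W1 := by nlinarith
              calc _ = A * A * X * (W1 * ((1 + ‖q‖) * W2)) := by ring
                _ ≤ _ := by gcongr
            linarith
  have hΦm := measurable_doubleKernel hB₀ hγ₀ hγ₁ s ζ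
  have hΦG : Measurable (fun p : R3 × R3 => ‖doubleKernel B₀ γ s ζ p.1 p.2‖ₑ *
      ENNReal.ofReal (exp (-α * ‖p.2‖ ^ 2))) := hΦm.enorm.mul hGm
  refine ⟨?_, fun a => ?_⟩
  · refine le_trans ?_ hDint
    rw [Measure.volume_eq_prod, lintegral_prod_symm _ hΦG.aemeasurable,
      lintegral_prod_symm _ hDGm.aemeasurable]
    refine lintegral_mono fun η => lintegral_mono_ae ?_
    filter_upwards [compl_mem_ae_iff.2 (measure_singleton ζ),
      compl_mem_ae_iff.2 (measure_singleton η)] with q h1 h2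
    refine mul_le_mul_left ?_ _
    rw [← ofReal_norm]
    exact ENNReal.ofReal_le_ofReal (hbasic q η h1 h2).1
  · have hΦm' : Measurable (fun p : R3 × R3 => doubleKernel B₀ γ s ζ (p.1 + a) p.2) :=
      measurable_comp_pair (k := doubleKernel B₀ γ s ζ) hΦm (measurable_fst.add_const a) measurable_snd
    have hΔG : Measurable (fun p : R3 × R3 =>
        ‖doubleKernel B₀ γ s ζ (p.1 + a) p.2 - doubleKernel B₀ γ s ζ p.1 p.2‖ₑ *
          ENNReal.ofReal (exp (-α * ‖p.2‖ ^ 2))) := (hΦm'.sub hΦm).enorm.mul hGm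
    have h1 : ∫⁻ p : R3 × R3,
        ‖doubleKernel B₀ γ s ζ (p.1 + a) p.2 - doubleKernel B₀ γ s ζ p.1 p.2‖ₑ *
          ENNReal.ofReal (exp (-α * ‖p.2‖ ^ 2)) ≤
        ‖a‖ₑ * ∫⁻ p : R3 × R3, ENNReal.ofReal (D p.1 p.2) *
          ENNReal.ofReal (exp (-α * ‖p.2‖ ^ 2)) := by
      rw [Measure.volume_eq_prod, lintegral_prod_symm _ hΔG.aemeasurable,
        lintegral_prod_symm _ hDGm.aemeasurable, ← lintegral_const_mul _ hDGm.lintegral_prod_left']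
      refine lintegral_mono fun η => ?_
      · have hDη : Measurable (fun q => D q η) :=
          measurable_comp_pair hDm measurable_id measurable_const
        have hΦη : Measurable (fun q => doubleKernel B₀ γ s ζ q η) :=
          measurable_comp_pair (k := doubleKernel B₀ γ s ζ) hΦm measurable_id measurable_const
        have hΦη' : Measurable (fun q => doubleKernel B₀ γ s ζ (q + a) η) :=
          measurable_comp_pair (k := doubleKernel B₀ γ s ζ) hΦm
            (measurable_add_const a) measurable_const
        dsimp only
        have hΔη : Measurable (fun q =>
            ‖doubleKernel B₀ γ s ζ (q + a) η - doubleKernel B₀ γ s ζ q η‖ₑ) := (hΦη'.sub hΦη).enorm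
        rw [lintegral_mul_const _ hΔη, lintegral_mul_const _ hDη.ennreal_ofReal,
          ← mul_assoc]
        refine mul_le_mul_left ?_ _
        refine lintegral_enorm_translate_sub_le (g := fun q => doubleKernel B₀ γ s ζ q η)
          (D := fun q => D q η) (ζ := ζ) (η := η) a (fun q => hD0 q η) hDη
          (fun q h1 h2 => (hbasic q η h1 h2).2) (fun q h1 h2 => ?_)
        have c1 := continuousAt_kernelWeight β h1
        have c2 := continuousAt_kernelWeight β h2
        have c3 : ContinuousAt (fun q => kernelWeight β q η) q := by
          have : (fun q => kernelWeight β q η) = kernelWeight β η :=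
            funext fun q => kernelWeight_symm _ _ _
          rwa [this]
        have c4 : ContinuousAt (fun q : R3 => 1 + ‖q‖) q := by fun_prop
        exact continuousAt_const.mul ((continuousAt_const.mul c1).mul (c4.mul c3))
    refine h1.trans ((mul_le_mul_right hDint _).trans (le_of_eq ?_))
    rw [← ofReal_norm, ← ENNReal.ofReal_mul (norm_nonneg _)]
    congr 1
    ring

/-! ### Exit times in a convex domain and the representative extended by zero. -/

theorem tauMinus_nonneg (Ω : Set R3) (x ζ : R3) : 0 ≤ tauMinus Ω x ζ :=
  Real.sInf_nonneg fun _ hs => hs.1.le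

theorem sub_smul_mem_of_lt_tauMinus {Ω : Set R3} {x ζ : R3} {s : ℝ} (hs : 0 < s)
    (h : s < tauMinus Ω x ζ) : x - s • ζ ∈ Ω := by
  by_contra hcon
  have : tauMinus Ω x ζ ≤ s := csInf_le ⟨0, fun _ ht => ht.1.le⟩ ⟨hs, hcon⟩
  linarith

/-- If a later point of the ray were in the open convex set, the open segment joining it to `x` in
the closure would be inside as well, contradicting an earlier exit. Boundedness makes the set of
exit times nonempty, so that its infimum is not a default value. -/
theorem sub_smul_notMem_of_tauMinus_lt {Ω : Set R3} (hΩo : IsOpen Ω) (hΩb : Bornology.IsBounded Ω)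
    (hΩc : Convex ℝ Ω) {x ζ : R3} (hx : x ∈ closure Ω) (hζ : ζ ≠ 0) {s : ℝ}
    (h : tauMinus Ω x ζ < s) : x - s • ζ ∉ Ω := by
  have hne : {s : ℝ | 0 < s ∧ x - s • ζ ∉ Ω}.Nonempty := by
    obtain ⟨R, hR⟩ := hΩb.exists_norm_le
    have hζ' : 0 < ‖ζ‖ := norm_pos_iff.2 hζ
    refine ⟨(|R| + ‖x‖ + 1) / ‖ζ‖, by positivity, fun hmem => ?_⟩
    have h1 := hR _ hmem
    have h2 : ‖((|R| + ‖x‖ + 1) / ‖ζ‖) • ζ‖ = |R| + ‖x‖ + 1 := by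
      rw [norm_smul, Real.norm_of_nonneg (by positivity)]
      field_simp
    have h3 := norm_sub_norm_le (((|R| + ‖x‖ + 1) / ‖ζ‖) • ζ) x
    rw [norm_sub_rev, h2] at h3
    linarith [le_abs_self R]
  obtain ⟨t, ⟨ht0, ht⟩, hts⟩ := exists_lt_of_csInf_lt hne h
  intro hmem
  apply ht
  have hs : 0 < s := ht0.trans hts
  have hsub := hΩc.openSegment_closure_interior_subset_interior hx
    (show x - s • ζ ∈ interior Ω by rwa [hΩo.interior_eq])
  rw [hΩo.interior_eq] at hsub
  apply hsub
  refine ⟨1 - t / s, t / s, ?_, by positivity, by ring, ?_⟩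
  · rw [sub_pos, div_lt_one hs]; exact hts
  · rw [smul_sub, smul_smul, div_mul_cancel₀ _ hs.ne']
    module

/-- Jointly measurable and pointwise bounded by `N e^{-α |η|²}`. -/
structure GaussianBounded (α N : ℝ) (g : R3 → R3 → ℝ) : Prop where
  measurable : Measurable (fun p : R3 × R3 => g p.1 p.2)
  abs_le : ∀ z η : R3, |g z η| ≤ N * exp (-α * ‖η‖ ^ 2)

theorem GaussianBounded.nonneg {α N : ℝ} {g : R3 → R3 → ℝ} (hg : GaussianBounded α N g) : 0 ≤ N :=
  nonneg_of_mul_nonneg_left ((abs_nonneg _).trans (hg.abs_le 0 0)) (exp_pos _)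

/-- A measurable representative of the weighted function is truncated at `±N` and cut off to `Ω`.
The bound then holds at every point, which is needed when it is evaluated along individual
characteristics. -/
theorem exists_gaussianBounded_ae_eq {α : ℝ} {Ω : Set R3} (hΩ : MeasurableSet Ω)
    {f : R3 → R3 → ℝ} (hf : MemLinfty α Ω f) :
    ∃ g : R3 → R3 → ℝ, GaussianBounded α (normLinfty α Ω f) g ∧
      (∀ z ∉ Ω, ∀ η, g z η = 0) ∧ ∀ᵐ z ∂(volume.restrict Ω), f z =ᵐ[volume] g z := by
  classical
  set N := normLinfty α Ω f with hN
  have hN0 : 0 ≤ N := ENNReal.toReal_nonneg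
  obtain ⟨W, hWs, hWeq⟩ := hf.1
  have hWm : Measurable W := hWs.measurable
  have hWN : ∀ᵐ p ∂(volume.restrict (Ω ×ˢ (univ : Set R3))), |weighted α f p| ≤ N := by
    have h1 := ae_le_eLpNormEssSup (f := weighted α f)
      (μ := volume.restrict (Ω ×ˢ (univ : Set R3)))
    filter_upwards [h1] with p hp
    rw [← eLpNorm_exponent_top, ← ofReal_norm] at hp
    exact (ENNReal.ofReal_le_iff_le_toReal hf.2.ne).1 hp
  refine ⟨fun z η => Ω.indicator (fun z => max (-N) (min N (W (z, η))) * exp (-α * ‖η‖ ^ 2)) z,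
    ⟨?_, ?_⟩, ?_, ?_⟩
  · have h1 : Measurable (fun p : R3 × R3 => max (-N) (min N (W p)) * exp (-α * ‖p.2‖ ^ 2)) := by
      fun_prop
    have h2 := h1.indicator (measurable_fst hΩ : MeasurableSet {p : R3 × R3 | p.1 ∈ Ω})
    exact h2
  · intro z η
    have hnn : 0 ≤ N * exp (-α * ‖η‖ ^ 2) := by positivity
    by_cases hz : z ∈ Ω
    · rw [indicator_of_mem hz, abs_mul, abs_of_pos (exp_pos _)]
      refine mul_le_mul_of_nonneg_right ?_ (exp_nonneg _)
      rw [abs_le]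
      exact ⟨le_max_left _ _, max_le (by linarith) (min_le_left _ _)⟩
    · rw [indicator_of_notMem hz, abs_zero]
      exact hnn
  · intro z hz η
    exact indicator_of_notMem hz _
  · have hprod : (volume : Measure (R3 × R3)).restrict (Ω ×ˢ (univ : Set R3)) =
        ((volume : Measure R3).restrict Ω).prod (volume : Measure R3) := by
      rw [Measure.volume_eq_prod, ← Measure.prod_restrict, Measure.restrict_univ]
    rw [hprod] at hWeq hWN
    have h1 := Measure.ae_ae_of_ae_prod (hWeq.and hWN)
    filter_upwards [h1, ae_restrict_mem hΩ] with z hz hzΩ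
    filter_upwards [hz] with η hη
    obtain ⟨e1, e2⟩ := hη
    rw [indicator_of_mem hzΩ, ← e1, min_eq_right (abs_le.1 e2).2, max_eq_right (abs_le.1 e2).1,
      weighted]
    dsimp only
    rw [mul_assoc, ← exp_add]
    simp

/-! ### `K` and damped transport on Gaussian-bounded functions; integration over travel time. -/

theorem exists_integral_kernelK_mul_le {B₀ γ α : ℝ} (hB₀ : 0 < B₀) (hγ₀ : 0 ≤ γ) (hγ₁ : γ ≤ 1)
    (hα₀ : 0 ≤ α) (hα₁ : α < 1 / 2) :
    ∃ C : ℝ, 0 < C ∧ ∀ (ζ : R3),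
      Integrable (fun q : R3 => |kernelK B₀ γ ζ q| * exp (-α * ‖q‖ ^ 2)) ∧
      ∀ (N : ℝ) (h : R3 → ℝ), AEStronglyMeasurable h volume →
        (∀ᵐ q : R3, |h q| ≤ N * exp (-α * ‖q‖ ^ 2)) →
        Integrable (fun q => kernelK B₀ γ ζ q * h q) ∧
        |∫ q, kernelK B₀ γ ζ q * h q| ≤ C * N * exp (-α * ‖ζ‖ ^ 2) := by
  obtain ⟨β, hβ1, hβ2⟩ := exists_between (show α / 2 < 1 / 4 by linarith)
  obtain ⟨A, hA0, hA⟩ := exists_kernelK_bounds hB₀ hγ₀ hγ₁ hβ2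
  obtain ⟨C, hC0, hC⟩ := exists_lintegral_kernelWeight_le hα₀ hβ1
  refine ⟨A * C, by positivity, fun ζ => ?_⟩
  have hkm : Measurable (fun q : R3 => kernelK B₀ γ ζ q) :=
    measurable_comp_pair (measurable_kernelK B₀ γ) measurable_const measurable_id
  have hgm : Measurable (fun q : R3 => exp (-α * ‖q‖ ^ 2)) := by fun_prop
  have hbm : Measurable (fun q : R3 => |kernelK B₀ γ ζ q| * exp (-α * ‖q‖ ^ 2)) :=
    (measurable_abs.comp hkm).mul hgm
  have hnn : ∀ q : R3, 0 ≤ |kernelK B₀ γ ζ q| * exp (-α * ‖q‖ ^ 2) := fun q => by positivity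
  have hlin : ∫⁻ q : R3, ENNReal.ofReal (|kernelK B₀ γ ζ q| * exp (-α * ‖q‖ ^ 2)) ≤
      ENNReal.ofReal (A * C * exp (-α * ‖ζ‖ ^ 2)) := by
    calc _ ≤ ∫⁻ q : R3, ENNReal.ofReal A *
          ENNReal.ofReal ((1 + ‖ζ‖) * kernelWeight β ζ q * exp (-α * ‖q‖ ^ 2)) := by
          refine lintegral_mono_ae ?_
          filter_upwards [compl_mem_ae_iff.2 (measure_singleton ζ)] with q hq
          rw [← ENNReal.ofReal_mul hA0.le]
          apply ENNReal.ofReal_le_ofReal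
          have h1 := (hA ζ q hq).1
          have h2 := kernelWeight_nonneg β ζ q
          have h3 : kernelWeight β ζ q ≤ (1 + ‖ζ‖) * kernelWeight β ζ q := by
            nlinarith [norm_nonneg ζ]
          calc _ ≤ A * kernelWeight β ζ q * exp (-α * ‖q‖ ^ 2) := by gcongr
            _ ≤ A * ((1 + ‖ζ‖) * kernelWeight β ζ q) * exp (-α * ‖q‖ ^ 2) := by gcongr
            _ = _ := by ring
      _ = ENNReal.ofReal A * ∫⁻ q : R3,
          ENNReal.ofReal ((1 + ‖ζ‖) * kernelWeight β ζ q * exp (-α * ‖q‖ ^ 2)) :=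
          lintegral_const_mul' _ _ ENNReal.ofReal_ne_top
      _ ≤ ENNReal.ofReal A * ENNReal.ofReal (C * exp (-α * ‖ζ‖ ^ 2)) := by
          gcongr
          exact hC ζ
      _ = _ := by
          rw [← ENNReal.ofReal_mul hA0.le, mul_assoc]
  have hint : Integrable (fun q : R3 => |kernelK B₀ γ ζ q| * exp (-α * ‖q‖ ^ 2)) := by
    refine ⟨hbm.aestronglyMeasurable, ?_⟩
    rw [hasFiniteIntegral_iff_ofReal (Eventually.of_forall hnn)]
    exact hlin.trans_lt ENNReal.ofReal_lt_top
  have hval : ∫ q : R3, |kernelK B₀ γ ζ q| * exp (-α * ‖q‖ ^ 2) ≤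
      A * C * exp (-α * ‖ζ‖ ^ 2) := by
    rw [← ofReal_integral_eq_lintegral_ofReal hint (Eventually.of_forall hnn)] at hlin
    exact (ENNReal.ofReal_le_ofReal_iff (by positivity)).1 hlin
  refine ⟨hint, fun N h hm hb => ?_⟩
  have hb' : ∀ᵐ q : R3, ‖kernelK B₀ γ ζ q * h q‖ ≤
      N * (|kernelK B₀ γ ζ q| * exp (-α * ‖q‖ ^ 2)) := by
    filter_upwards [hb] with q hq
    rw [norm_mul, Real.norm_eq_abs, Real.norm_eq_abs]
    calc _ ≤ |kernelK B₀ γ ζ q| * (N * exp (-α * ‖q‖ ^ 2)) := by gcongr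
      _ = _ := by ring
  have hN : 0 ≤ N := by
    obtain ⟨q, hq⟩ := hb.exists
    exact nonneg_of_mul_nonneg_left ((abs_nonneg _).trans hq) (exp_pos _)
  refine ⟨(hint.const_mul N).mono' (hkm.aestronglyMeasurable.mul hm) hb', ?_⟩
  have h1 := norm_integral_le_of_norm_le (hint.const_mul N) hb'
  rw [integral_const_mul, Real.norm_eq_abs] at h1
  calc _ ≤ _ := h1
    _ ≤ N * (A * C * exp (-α * ‖ζ‖ ^ 2)) := by gcongr
    _ = _ := by ring

/-- The first bound is used on `(0, d]` and the second beyond: `(0, d]` contributes `d`, `(d, 1]`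
contributes `d|log d|` (it is empty for `d ≥ 1`), and the tail at most `d/κ`. -/
theorem exists_integral_Ioi_log_le {κ : ℝ} (hκ : 0 < κ) :
    ∃ C : ℝ, 0 < C ∧ ∀ (K d : ℝ) (φ : ℝ → ℝ), 0 ≤ K → 0 < d →
      (∀ s, 0 < s → |φ s| ≤ K * exp (-κ * s)) →
      (∀ s, 0 < s → |φ s| ≤ K * (d / s) * exp (-κ * s)) →
      |∫ s in Ioi (0 : ℝ), φ s| ≤ K * C * (d * (1 + |log d|)) := by
  refine ⟨1 + 1 / κ, by positivity, fun K d φ hK hd h1 h2 => ?_⟩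
  have hexp : IntegrableOn (fun s : ℝ => exp (-κ * s)) (Ioi 0) :=
    integrableOn_exp_mul_Ioi (by linarith) 0
  have hind1 : Integrable ((Ioc 0 d).indicator (fun _ : ℝ => (1 : ℝ)))
      (volume.restrict (Ioi (0 : ℝ))) := by
    refine Integrable.integrableOn ?_
    rw [integrable_indicator_iff measurableSet_Ioc]
    exact integrableOn_const (by simp)
  have hinvc : ContinuousOn (fun s : ℝ => s⁻¹) (Icc d 1) :=
    continuousOn_inv₀.mono fun s hs => (hd.trans_le hs.1).ne'
  have hind2 : Integrable ((Ioc d 1).indicator (fun s : ℝ => s⁻¹))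
      (volume.restrict (Ioi (0 : ℝ))) := by
    refine Integrable.integrableOn ?_
    rw [integrable_indicator_iff measurableSet_Ioc]
    exact hinvc.integrableOn_Icc.mono_set Ioc_subset_Icc_self
  set b : ℝ → ℝ := fun s => K * ((Ioc 0 d).indicator (fun _ : ℝ => (1 : ℝ)) s +
    d * (Ioc d 1).indicator (fun s : ℝ => s⁻¹) s + d * exp (-κ * s)) with hb
  have hbi : Integrable b (volume.restrict (Ioi (0 : ℝ))) :=
    ((hind1.add (hind2.const_mul d)).add (hexp.const_mul d)).const_mul K
  have hle : ∀ᵐ s ∂(volume.restrict (Ioi (0 : ℝ))), ‖φ s‖ ≤ b s := by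
    filter_upwards [ae_restrict_mem measurableSet_Ioi] with s hs
    have hs : 0 < s := hs
    have he : exp (-κ * s) ≤ 1 := exp_le_one_iff.2 (by nlinarith)
    have he0 : 0 < exp (-κ * s) := exp_pos _
    rw [Real.norm_eq_abs, hb]
    dsimp only
    by_cases hsd : s ≤ d
    · rw [indicator_of_mem (show s ∈ Ioc 0 d from ⟨hs, hsd⟩)]
      have h3 : 0 ≤ (Ioc d 1).indicator (fun s : ℝ => s⁻¹) s :=
        indicator_nonneg (fun t ht => inv_nonneg.2 (hd.trans ht.1).le) s
      refine (h1 s hs).trans ?_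
      gcongr
      nlinarith [mul_nonneg hd.le h3, mul_pos hd he0]
    · rw [not_le] at hsd
      rw [indicator_of_notMem (fun h : s ∈ Ioc 0 d => absurd h.2 (not_le.2 hsd))]
      by_cases hs1 : s ≤ 1
      · rw [indicator_of_mem (show s ∈ Ioc d 1 from ⟨hsd, hs1⟩)]
        refine (h2 s hs).trans ?_
        rw [mul_assoc]
        gcongr
        have : d / s * exp (-κ * s) ≤ d / s * 1 := by gcongr
        rw [div_eq_mul_inv] at this ⊢
        nlinarith [mul_pos hd he0]
      · rw [not_le] at hs1
        rw [indicator_of_notMem (fun h : s ∈ Ioc d 1 => absurd h.2 (not_le.2 hs1))]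
        refine (h2 s hs).trans ?_
        rw [mul_assoc]
        gcongr
        have : d / s ≤ d := div_le_self hd.le hs1.le
        have : d / s * exp (-κ * s) ≤ d * exp (-κ * s) := by gcongr
        linarith
  have hint := norm_integral_le_of_norm_le hbi hle
  rw [Real.norm_eq_abs] at hint
  refine hint.trans ?_
  rw [hb, integral_const_mul, mul_assoc]
  refine mul_le_mul_of_nonneg_left ?_ hK
  have e1 : ∫ s in Ioi (0 : ℝ), (Ioc 0 d).indicator (fun _ : ℝ => (1 : ℝ)) s = d := by
    rw [setIntegral_indicator measurableSet_Ioc,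
      inter_eq_right.2 (Ioc_subset_Ioi_self : Ioc (0 : ℝ) d ⊆ Ioi 0)]
    simp [hd.le]
  have e2 : ∫ s in Ioi (0 : ℝ), (Ioc d 1).indicator (fun s : ℝ => s⁻¹) s ≤ |log d| := by
    rw [setIntegral_indicator measurableSet_Ioc,
      inter_eq_right.2 (show Ioc d 1 ⊆ Ioi 0 from fun s hs => hd.trans hs.1)]
    by_cases hd1 : d ≤ 1
    · rw [← intervalIntegral.integral_of_le hd1, integral_inv_of_pos hd one_pos, one_div, log_inv]
      exact neg_le_abs _
    · rw [Ioc_eq_empty (fun h => hd1 h.le)]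
      simp
  have e3 : ∫ s in Ioi (0 : ℝ), exp (-κ * s) = 1 / κ := by
    rw [integral_exp_mul_Ioi (by linarith) 0]
    simp
  have i12 : Integrable (fun s => (Ioc 0 d).indicator (fun _ : ℝ => (1 : ℝ)) s +
      d * (Ioc d 1).indicator (fun s : ℝ => s⁻¹) s) (volume.restrict (Ioi (0 : ℝ))) :=
    hind1.add (hind2.const_mul d)
  rw [integral_add i12 (hexp.const_mul d),
    integral_add hind1 (hind2.const_mul d), integral_const_mul, integral_const_mul, e1, e3]
  have hk : 0 < 1 / κ := by positivity
  have hl := abs_nonneg (log d)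
  nlinarith [mul_le_mul_of_nonneg_left e2 hd.le, mul_nonneg hk.le (mul_nonneg hd.le hl)]

/-- The damped transport of `F` along the full backward characteristic. -/
noncomputable def transport (B₀ γ : ℝ) (F : R3 → R3 → ℝ) (x q : R3) : ℝ :=
  ∫ s in Ioi (0 : ℝ), exp (-nu B₀ γ q * s) * F (x - s • q) q

/-- The contribution of the travel time `s` to `K S K g`. -/
noncomputable def timeSlice (B₀ γ : ℝ) (F : R3 → R3 → ℝ) (s : ℝ) (x ζ : R3) : ℝ :=
  ∫ q : R3, kernelK B₀ γ ζ q * (exp (-nu B₀ γ q * s) * F (x - s • q) q)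

/-- For fixed `s > 0` the map `q ↦ x - s q` pulls null sets back to null sets; exchanging the
quantifiers is Tonelli. Properties of almost every position thus hold along almost every ray issued
from every single `x`. -/
theorem ae_ae_sub_smul {P : R3 → Prop} (hP : ∀ᵐ z : R3, P z) (x : R3) :
    ∀ᵐ q : R3, ∀ᵐ s ∂(volume.restrict (Ioi (0 : ℝ))), P (x - s • q) := by
  obtain ⟨t, htP, htm, ht0⟩ := exists_measurable_superset_of_null (ae_iff.1 hP)
  have hcont : Continuous (fun p : R3 × ℝ => x - p.2 • p.1) := by fun_prop
  have hm : MeasurableSet {p : R3 × ℝ | x - p.2 • p.1 ∉ t} := hcont.measurable htm.compl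
  have h1 : ∀ᵐ q : R3, ∀ᵐ s ∂(volume.restrict (Ioi (0 : ℝ))), x - s • q ∉ t := by
    rw [Measure.ae_ae_comm hm]
    filter_upwards [ae_restrict_mem measurableSet_Ioi] with s hs
    have hs : s ≠ 0 := (show (0 : ℝ) < s from hs).ne'
    rw [ae_iff]
    simp only [not_not]
    have e : {q : R3 | x - s • q ∈ t} = (fun q => s • q) ⁻¹' ((fun w => x - w) ⁻¹' t) := rfl
    rw [e, Measure.addHaar_preimage_smul _ hs,
      (Measure.measurePreserving_sub_left volume x).measure_preimage htm.nullMeasurableSet, ht0,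
      mul_zero]
  filter_upwards [h1] with q hq
  filter_upwards [hq] with s hs
  by_contra hcon
  exact hs (htP hcon)

theorem measurable_opK {B₀ γ α N : ℝ} {g : R3 → R3 → ℝ} (hg : GaussianBounded α N g) :
    Measurable (fun p : R3 × R3 => opK B₀ γ g p.1 p.2) := by
  have h1 : Measurable (fun p : (R3 × R3) × R3 => kernelK B₀ γ p.1.2 p.2) :=
    measurable_comp_pair (measurable_kernelK B₀ γ) measurable_fst.snd measurable_snd
  have h2 : Measurable (fun p : (R3 × R3) × R3 => g p.1.1 p.2) :=
    measurable_comp_pair hg.measurable measurable_fst.fst measurable_snd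
  exact (h1.mul h2).stronglyMeasurable.integral_prod_right'.measurable

theorem exists_gaussianBounded_opK {B₀ γ α : ℝ} (hB₀ : 0 < B₀) (hγ₀ : 0 ≤ γ) (hγ₁ : γ ≤ 1)
    (hα₀ : 0 ≤ α) (hα₁ : α < 1 / 2) :
    ∃ C : ℝ, 0 < C ∧ ∀ (N : ℝ) (g : R3 → R3 → ℝ), GaussianBounded α N g →
      GaussianBounded α (C * N) (opK B₀ γ g) := by
  obtain ⟨C, hC0, hC⟩ := exists_integral_kernelK_mul_le hB₀ hγ₀ hγ₁ hα₀ hα₁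
  refine ⟨C, hC0, fun N g hg => ⟨measurable_opK hg, fun z ζ => ?_⟩⟩
  have hm : Measurable (g z) :=
    measurable_comp_pair hg.measurable measurable_const measurable_id
  exact ((hC ζ).2 N (g z) hm.aestronglyMeasurable (Eventually.of_forall (hg.abs_le z))).2

section Transport

variable {B₀ γ α N : ℝ} {F : R3 → R3 → ℝ}

theorem measurable_transport_integrand (hB₀ : 0 < B₀) (hγ₀ : 0 ≤ γ) (hγ₁ : γ ≤ 1)
    (hF : GaussianBounded α N F) (x : R3) :
    Measurable (fun p : R3 × ℝ => exp (-nu B₀ γ p.1 * p.2) * F (x - p.2 • p.1) p.1) := by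
  have hν := (continuous_nu hB₀ hγ₀ hγ₁).measurable
  have h1 : Measurable (fun p : R3 × ℝ => exp (-nu B₀ γ p.1 * p.2)) :=
    ((hν.comp measurable_fst).neg.mul measurable_snd).exp
  have h2 : Measurable (fun p : R3 × ℝ => x - p.2 • p.1) := by fun_prop
  exact h1.mul (measurable_comp_pair hF.measurable h2 measurable_fst)

theorem abs_transport_integrand_le (hF : GaussianBounded α N F) {κ c : ℝ}
    (hc : ∀ (ζ : R3) (s : ℝ), 0 ≤ s → exp (-nu B₀ γ ζ * s) ≤ c * exp (-κ * s)) (x q : R3) {s : ℝ}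
    (hs : 0 ≤ s) :
    |exp (-nu B₀ γ q * s) * F (x - s • q) q| ≤
      c * N * exp (-κ * s) * exp (-α * ‖q‖ ^ 2) := by
  rw [abs_mul, abs_of_pos (exp_pos _)]
  calc _ ≤ (c * exp (-κ * s)) * (N * exp (-α * ‖q‖ ^ 2)) :=
        mul_le_mul (hc q s hs) (hF.abs_le _ _) (abs_nonneg _) ((exp_nonneg _).trans (hc q s hs))
    _ = _ := by ring

theorem exists_transport_bounds (hB₀ : 0 < B₀) (hγ₀ : 0 ≤ γ) (hγ₁ : γ ≤ 1) :
    ∃ C : ℝ, 0 < C ∧ ∀ (α N : ℝ) (F : R3 → R3 → ℝ), GaussianBounded α N F → ∀ x q : R3,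
      IntegrableOn (fun s => exp (-nu B₀ γ q * s) * F (x - s • q) q) (Ioi 0) ∧
      |transport B₀ γ F x q| ≤ C * N * exp (-α * ‖q‖ ^ 2) := by
  obtain ⟨κ, c, hκ, hc1, hc⟩ := exists_slopeLE_exp_nu hB₀ hγ₀ hγ₁
  refine ⟨c / κ, by positivity, fun α N F hF x q => ?_⟩
  have hm : Measurable (fun s : ℝ => exp (-nu B₀ γ q * s) * F (x - s • q) q) :=
    measurable_comp_pair (k := fun q s => exp (-nu B₀ γ q * s) * F (x - s • q) q)
      (measurable_transport_integrand hB₀ hγ₀ hγ₁ hF x) measurable_const measurable_id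
  have hexp : IntegrableOn (fun s : ℝ => exp (-κ * s)) (Ioi 0) :=
    integrableOn_exp_mul_Ioi (by linarith) 0
  have hb : IntegrableOn (fun s : ℝ => c * N * exp (-κ * s) * exp (-α * ‖q‖ ^ 2)) (Ioi 0) :=
    (hexp.const_mul _).mul_const _
  have hle : ∀ᵐ s ∂(volume.restrict (Ioi (0 : ℝ))),
      ‖exp (-nu B₀ γ q * s) * F (x - s • q) q‖ ≤
        c * N * exp (-κ * s) * exp (-α * ‖q‖ ^ 2) := by
    filter_upwards [ae_restrict_mem measurableSet_Ioi] with s hs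
    exact abs_transport_integrand_le hF (fun ζ s hs => (hc ζ s hs).1) x q (le_of_lt hs)
  refine ⟨hb.mono' hm.aestronglyMeasurable hle, ?_⟩
  have := norm_integral_le_of_norm_le hb hle
  rw [integral_mul_const, integral_const_mul, integral_exp_mul_Ioi (by linarith) 0,
    Real.norm_eq_abs] at this
  refine this.trans (le_of_eq ?_)
  simp
  field_simp

theorem measurable_transport (hB₀ : 0 < B₀) (hγ₀ : 0 ≤ γ) (hγ₁ : γ ≤ 1)
    (hF : GaussianBounded α N F) (x : R3) : Measurable (transport B₀ γ F x) :=
  (measurable_transport_integrand hB₀ hγ₀ hγ₁ hF x).stronglyMeasurable.integral_prod_right'.measurable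

/-- Fubini in velocity and travel time, the integrand being dominated by a product of `|k(ζ,q)|
e^{-α|q|²}` and an exponential in `s`. -/
theorem integral_kernelK_mul_transport (hB₀ : 0 < B₀) (hγ₀ : 0 ≤ γ) (hγ₁ : γ ≤ 1)
    (hα₀ : 0 ≤ α) (hα₁ : α < 1 / 2) (hF : GaussianBounded α N F) (x ζ : R3) :
    IntegrableOn (fun s => timeSlice B₀ γ F s x ζ) (Ioi 0) ∧
    ∫ q : R3, kernelK B₀ γ ζ q * transport B₀ γ F x q =
      ∫ s in Ioi (0 : ℝ), timeSlice B₀ γ F s x ζ := by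
  obtain ⟨κ, c, hκ, hc1, hc⟩ := exists_slopeLE_exp_nu hB₀ hγ₀ hγ₁
  obtain ⟨C, hC0, hC⟩ := exists_integral_kernelK_mul_le hB₀ hγ₀ hγ₁ hα₀ hα₁
  have hexp : IntegrableOn (fun s : ℝ => c * N * exp (-κ * s)) (Ioi 0) :=
    (integrableOn_exp_mul_Ioi (by linarith) 0).const_mul _
  have hb := (hC ζ).1.mul_prod hexp
  have hk : Measurable (fun p : R3 × ℝ => kernelK B₀ γ ζ p.1) :=
    measurable_comp_pair (measurable_kernelK B₀ γ) measurable_const measurable_fst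
  have hm : Measurable (fun p : R3 × ℝ =>
      kernelK B₀ γ ζ p.1 * (exp (-nu B₀ γ p.1 * p.2) * F (x - p.2 • p.1) p.1)) :=
    hk.mul (measurable_transport_integrand hB₀ hγ₀ hγ₁ hF x)
  have hpos : ∀ᵐ p ∂((volume : Measure R3).prod (volume.restrict (Ioi (0 : ℝ)))), 0 < p.2 :=
    (Measure.quasiMeasurePreserving_snd (μ := (volume : Measure R3))
      (ν := volume.restrict (Ioi (0 : ℝ)))).ae (ae_restrict_mem measurableSet_Ioi)
  have hint : Integrable (fun p : R3 × ℝ =>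
      kernelK B₀ γ ζ p.1 * (exp (-nu B₀ γ p.1 * p.2) * F (x - p.2 • p.1) p.1))
      ((volume : Measure R3).prod (volume.restrict (Ioi (0 : ℝ)))) := by
    refine hb.mono' hm.aestronglyMeasurable ?_
    filter_upwards [hpos] with p hp
    have := abs_transport_integrand_le hF (fun ζ s hs => (hc ζ s hs).1) x p.1 hp.le
    rw [norm_mul, Real.norm_eq_abs, Real.norm_eq_abs]
    calc _ ≤ |kernelK B₀ γ ζ p.1| * (c * N * exp (-κ * p.2) * exp (-α * ‖p.1‖ ^ 2)) := by gcongr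
      _ = _ := by ring
  refine ⟨hint.integral_prod_right, ?_⟩
  rw [show (∫ s in Ioi (0 : ℝ), timeSlice B₀ γ F s x ζ) = ∫ s in Ioi (0 : ℝ), ∫ q : R3,
    kernelK B₀ γ ζ q * (exp (-nu B₀ γ q * s) * F (x - s • q) q) from rfl,
    ← integral_integral_swap (f := fun (q : R3) (s : ℝ) =>
      kernelK B₀ γ ζ q * (exp (-nu B₀ γ q * s) * F (x - s • q) q)) hint]
  refine integral_congr_ae (Eventually.of_forall fun q => ?_)
  simp only [transport]
  rw [integral_const_mul]

end Transport

/-- The contribution of a single travel time is bounded, and Lipschitz in the position with a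
constant that is inversely proportional to the travel time. -/
theorem exists_timeSlice_bounds {B₀ γ α : ℝ} (hB₀ : 0 < B₀) (hγ₀ : 0 ≤ γ) (hγ₁ : γ ≤ 1)
    (hα₀ : 0 ≤ α) (hα₁ : α < 1 / 2) :
    ∃ κ C : ℝ, 0 < κ ∧ 0 < C ∧ ∀ (N : ℝ) (g : R3 → R3 → ℝ), GaussianBounded α N g →
      ∀ (s : ℝ), 0 < s → ∀ x y ζ : R3,
        |timeSlice B₀ γ (opK B₀ γ g) s x ζ| ≤ C * N * exp (-α * ‖ζ‖ ^ 2) * exp (-κ * s) ∧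
        |timeSlice B₀ γ (opK B₀ γ g) s x ζ - timeSlice B₀ γ (opK B₀ γ g) s y ζ| ≤
          C * N * exp (-α * ‖ζ‖ ^ 2) * (‖x - y‖ / s) * exp (-κ * s) := by
  obtain ⟨κ, C, hκ, hC0, hC⟩ := exists_lintegral_doubleKernel_le hB₀ hγ₀ hγ₁ hα₀ hα₁
  refine ⟨κ, C, hκ, hC0, fun N g hg s hs x y ζ => ?_⟩
  obtain ⟨hA, hB⟩ := hC ζ s hs.le
  have hN := hg.nonneg
  have hΦm := measurable_doubleKernel hB₀ hγ₀ hγ₁ s ζ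
  have hgm : ∀ x : R3, Measurable (fun p : R3 × R3 => g (x - s • p.1) p.2) := fun x =>
    measurable_comp_pair hg.measurable (by fun_prop) measurable_snd
  have hcontrol : ∀ (Ψ : R3 × R3 → ℝ) (x : R3) (M : ℝ), 0 ≤ M → Measurable Ψ →
      ∫⁻ p, ‖Ψ p‖ₑ * ENNReal.ofReal (exp (-α * ‖p.2‖ ^ 2)) ≤ ENNReal.ofReal M →
      Integrable (fun p : R3 × R3 => Ψ p * g (x - s • p.1) p.2) ∧
      |∫ p : R3 × R3, Ψ p * g (x - s • p.1) p.2| ≤ N * M := by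
    intro Ψ x M hM hΨ hle
    have h1 : ∫⁻ p : R3 × R3, ‖Ψ p * g (x - s • p.1) p.2‖ₑ ≤ ENNReal.ofReal (N * M) := by
      calc _ ≤ ∫⁻ p : R3 × R3, ENNReal.ofReal N *
            (‖Ψ p‖ₑ * ENNReal.ofReal (exp (-α * ‖p.2‖ ^ 2))) := by
            refine lintegral_mono fun p => ?_
            rw [enorm_mul, mul_left_comm, ← ENNReal.ofReal_mul hN]
            gcongr
            rw [← ofReal_norm]
            exact ENNReal.ofReal_le_ofReal (hg.abs_le _ _)
        _ = ENNReal.ofReal N * ∫⁻ p, ‖Ψ p‖ₑ * ENNReal.ofReal (exp (-α * ‖p.2‖ ^ 2)) :=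
            lintegral_const_mul' _ _ ENNReal.ofReal_ne_top
        _ ≤ ENNReal.ofReal N * ENNReal.ofReal M := by gcongr
        _ = _ := (ENNReal.ofReal_mul hN).symm
    refine ⟨⟨(hΨ.mul (hgm x)).aestronglyMeasurable, h1.trans_lt ENNReal.ofReal_lt_top⟩, ?_⟩
    have h2 := (enorm_integral_le_lintegral_enorm
      (fun p : R3 × R3 => Ψ p * g (x - s • p.1) p.2)).trans h1
    rw [← ofReal_norm, Real.norm_eq_abs] at h2
    exact (ENNReal.ofReal_le_ofReal_iff (by positivity)).1 h2
  have hmain : ∀ x : R3, timeSlice B₀ γ (opK B₀ γ g) s x ζ =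
      ∫ p : R3 × R3, doubleKernel B₀ γ s ζ p.1 p.2 * g (x - s • p.1) p.2 := by
    intro x
    have hi := (hcontrol (fun p => doubleKernel B₀ γ s ζ p.1 p.2) x _ (by positivity) hΦm hA).1
    rw [Measure.volume_eq_prod] at hi ⊢
    rw [integral_prod _ hi, timeSlice]
    refine integral_congr_ae (Eventually.of_forall fun q => ?_)
    simp only [opK, doubleKernel]
    rw [← mul_assoc, ← integral_const_mul]
    refine integral_congr_ae (Eventually.of_forall fun η => ?_)
    simp only
    ring
  constructor
  · rw [hmain]
    refine (hcontrol (fun p => doubleKernel B₀ γ s ζ p.1 p.2) x _ (by positivity) hΦm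
      hA).2.trans (le_of_eq ?_)
    ring
  -- This shift satisfies `x - s(q + a) = y - s q`: translating only the intermediate velocity
  -- leaves the same values of `g` in both slices and puts the difference on the kernel.
  · set a : R3 := s⁻¹ • (x - y) with ha
    have hΦm' : Measurable (fun p : R3 × R3 => doubleKernel B₀ γ s ζ (p.1 + a) p.2) :=
      measurable_comp_pair (k := doubleKernel B₀ γ s ζ) hΦm (measurable_fst.add_const a)
        measurable_snd
    have hix := (hcontrol (fun p => doubleKernel B₀ γ s ζ p.1 p.2) x _ (by positivity) hΦm hA).1
    have hiy := (hcontrol (fun p => doubleKernel B₀ γ s ζ p.1 p.2) y _ (by positivity) hΦm hA).1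
    have hsa : ∀ q : R3, x - s • (q + a) = y - s • q := by
      intro q
      rw [ha, smul_add, smul_smul, mul_inv_cancel₀ hs.ne', one_smul]
      abel
    have hshift : ∫ p : R3 × R3, doubleKernel B₀ γ s ζ (p.1 + a) p.2 * g (y - s • p.1) p.2 =
        ∫ p : R3 × R3, doubleKernel B₀ γ s ζ p.1 p.2 * g (x - s • p.1) p.2 := by
      rw [Measure.volume_eq_prod, ← integral_add_right_eq_self
        (fun p : R3 × R3 => doubleKernel B₀ γ s ζ p.1 p.2 * g (x - s • p.1) p.2) ((a, 0) : R3 × R3)]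
      simp only [Prod.fst_add, Prod.snd_add, add_zero, hsa]
    have hix' : Integrable
        (fun p : R3 × R3 => doubleKernel B₀ γ s ζ (p.1 + a) p.2 * g (y - s • p.1) p.2) := by
      rw [Measure.volume_eq_prod] at hix ⊢
      have := hix.comp_add_right ((a, 0) : R3 × R3)
      simpa only [Prod.fst_add, Prod.snd_add, add_zero, hsa] using this
    rw [hmain, hmain, ← hshift, ← integral_sub hix' hiy]
    simp only [← sub_mul]
    refine (hcontrol (fun p => doubleKernel B₀ γ s ζ (p.1 + a) p.2 - doubleKernel B₀ γ s ζ p.1 p.2)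
      y _ (by positivity) (hΦm'.sub hΦm) (hB a)).2.trans (le_of_eq ?_)
    rw [ha, norm_smul, norm_inv, Real.norm_of_nonneg hs.le]
    ring

/-- On a bounded convex domain `S_Ω` is the transport of the extension by zero. -/
theorem ae_opS_eq_transport {B₀ γ α N : ℝ} (hB₀ : 0 < B₀) (hγ₀ : 0 ≤ γ) (hγ₁ : γ ≤ 1)
    {Ω : Set R3} (hΩo : IsOpen Ω) (hΩb : Bornology.IsBounded Ω) (hΩc : Convex ℝ Ω)
    {H F : R3 → R3 → ℝ} (hF : GaussianBounded α N F) (hF0 : ∀ z ∉ Ω, ∀ q, F z q = 0)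
    (hHF : ∀ᵐ z : R3, z ∈ Ω → ∀ q, H z q = F z q) {x : R3} (hx : x ∈ closure Ω) :
    ∀ᵐ q : R3,
      IntervalIntegrable (fun s : ℝ => exp (-nu B₀ γ q * s) * H (x - s • q) q) volume 0
        (tauMinus Ω x q) ∧
      opS B₀ γ Ω H x q = transport B₀ γ F x q := by
  obtain ⟨C, hC0, hC⟩ := exists_transport_bounds hB₀ hγ₀ hγ₁
  filter_upwards [ae_ae_sub_smul hHF x, compl_mem_ae_iff.2 (measure_singleton (0 : R3))] with q hq hq0
  have hτ := tauMinus_nonneg Ω x q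
  set τ := tauMinus Ω x q with hτdef
  have hint := (hC α N F hF x q).1
  have hsub : Ioc 0 τ ⊆ Ioi (0 : ℝ) := Ioc_subset_Ioi_self
  have hae : ∀ᵐ s ∂(volume.restrict (Ioc (0 : ℝ) τ)),
      exp (-nu B₀ γ q * s) * F (x - s • q) q = exp (-nu B₀ γ q * s) * H (x - s • q) q := by
    -- At the exit time the point need not lie in `Ω`, where alone `H` and `F` are known to agree; a
    -- single time is negligible.
    have hne : ∀ᵐ s : ℝ, s ≠ τ := compl_mem_ae_iff.2 (measure_singleton τ)
    filter_upwards [ae_restrict_of_ae_restrict_of_subset hsub hq,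
      ae_restrict_mem measurableSet_Ioc, ae_restrict_of_ae hne] with s h1 h2 h3
    rw [h1 (sub_smul_mem_of_lt_tauMinus h2.1 (lt_of_le_of_ne h2.2 h3))]
  refine ⟨?_, ?_⟩
  · rw [intervalIntegrable_iff_integrableOn_Ioc_of_le hτ]
    exact (hint.mono_set hsub).congr hae
  · rw [opS, intervalIntegral.integral_of_le hτ, transport, ← integral_congr_ae hae]
    refine (setIntegral_eq_of_subset_of_forall_sdiff_eq_zero measurableSet_Ioi hsub ?_).symm
    intro s hs
    have : τ < s := by
      by_contra hcon
      exact hs.2 ⟨hs.1, not_lt.1 hcon⟩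
    rw [hF0 _ (sub_smul_notMem_of_tauMinus_lt hΩo hΩb hΩc hx hq0 this), mul_zero]

end LinBoltzmann


/-! ### Assembly of the estimate. -/

theorem proposition3p5 (B₀ γ : ℝ) (hB₀ : 0 < B₀) (hγ₀ : 0 ≤ γ) (hγ₁ : γ ≤ 1)
    (Ω : Set LinBoltzmann.R3) (hΩo : IsOpen Ω) (hΩb : Bornology.IsBounded Ω)
    (hΩc : Convex ℝ Ω) (α : ℝ) (hα₀ : 0 ≤ α) (hα₁ : α < 1 / 2) :
    ∃ C : ℝ, 0 < C ∧ ∀ f : LinBoltzmann.R3 → LinBoltzmann.R3 → ℝ,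
      LinBoltzmann.MemLinfty α Ω f →
      -- the integrals that define `G` on `closure Ω × ℝ³` converge absolutely
      (∀ᵐ z ∂(volume.restrict Ω), ∀ ζ : LinBoltzmann.R3,
        Integrable (fun ζs : LinBoltzmann.R3 => LinBoltzmann.kernelK B₀ γ ζ ζs * f z ζs)) ∧
      (∀ x ∈ closure Ω, ∀ᵐ ζs : LinBoltzmann.R3,
        IntervalIntegrable
          (fun s : ℝ => Real.exp (-LinBoltzmann.nu B₀ γ ζs * s) *
            LinBoltzmann.opK B₀ γ f (x - s • ζs) ζs)
          volume 0 (LinBoltzmann.tauMinus Ω x ζs)) ∧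
      (∀ x ∈ closure Ω, ∀ ζ : LinBoltzmann.R3,
        Integrable (fun ζs : LinBoltzmann.R3 => LinBoltzmann.kernelK B₀ γ ζ ζs *
          LinBoltzmann.opS B₀ γ Ω (LinBoltzmann.opK B₀ γ f) x ζs)) ∧
      -- the log-Lipschitz estimate
      ∀ x ∈ closure Ω, ∀ y ∈ closure Ω, ∀ ζ : LinBoltzmann.R3,
        |LinBoltzmann.opG B₀ γ Ω f x ζ - LinBoltzmann.opG B₀ γ Ω f y ζ| ≤
          C * LinBoltzmann.normLinfty α Ω f * ‖x - y‖ * (1 + |Real.log ‖x - y‖|) *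
            Real.exp (-α * ‖ζ‖ ^ 2) := by
  open LinBoltzmann in
  obtain ⟨C₁, hC1, hK⟩ := exists_integral_kernelK_mul_le hB₀ hγ₀ hγ₁ hα₀ hα₁
  obtain ⟨C₂, hC2, hKg⟩ := exists_gaussianBounded_opK hB₀ hγ₀ hγ₁ hα₀ hα₁
  obtain ⟨C₃, hC3, hT⟩ := exists_transport_bounds hB₀ hγ₀ hγ₁
  obtain ⟨κ, C₄, hκ, hC4, hI⟩ := exists_timeSlice_bounds hB₀ hγ₀ hγ₁ hα₀ hα₁
  obtain ⟨C₅, hC5, hlog⟩ := exists_integral_Ioi_log_le hκ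
  -- The factor `2` comes from bounding the difference of two slices by the sum of their sizes for
  -- short times.
  refine ⟨2 * C₄ * C₅, by positivity, fun f hf => ?_⟩
  obtain ⟨g, hg, hg0, hfg⟩ := exists_gaussianBounded_ae_eq hΩo.measurableSet hf
  set N := normLinfty α Ω f
  have hN : 0 ≤ N := hg.nonneg
  have hF := hKg N g hg
  have hF0 : ∀ z ∉ Ω, ∀ q, opK B₀ γ g z q = 0 := fun z hz q => by
    simp [opK, hg0 z hz]
  -- The exceptional set is in position only, since `K` integrates out the velocity of `f`.
  have hHF : ∀ᵐ z : R3, z ∈ Ω → ∀ q, opK B₀ γ f z q = opK B₀ γ g z q := by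
    rw [ae_restrict_iff' hΩo.measurableSet] at hfg
    filter_upwards [hfg] with z hz hzΩ q
    refine integral_congr_ae ?_
    filter_upwards [hz hzΩ] with η hη
    rw [hη]
  have hS : ∀ x ∈ closure Ω, _ := fun x hx =>
    ae_opS_eq_transport hB₀ hγ₀ hγ₁ hΩo hΩb hΩc hF hF0 hHF hx
  have hG : ∀ x ∈ closure Ω, ∀ ζ : R3, opG B₀ γ Ω f x ζ =
      ∫ s in Ioi (0 : ℝ), timeSlice B₀ γ (opK B₀ γ g) s x ζ := by
    intro x hx ζ
    rw [← (integral_kernelK_mul_transport hB₀ hγ₀ hγ₁ hα₀ hα₁ hF x ζ).2, opG, opK]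
    refine integral_congr_ae ?_
    filter_upwards [hS x hx] with q hq
    rw [hq.2]
  refine ⟨?_, fun x hx => (hS x hx).mono fun q hq => hq.1, ?_, ?_⟩
  · filter_upwards [hfg] with z hz ζ
    have hm : Measurable (g z) :=
      measurable_comp_pair hg.measurable measurable_const measurable_id
    refine ((hK ζ).2 N (f z) (hm.aestronglyMeasurable.congr hz.symm) ?_).1
    filter_upwards [hz] with η hη
    rw [hη]
    exact hg.abs_le z η
  · intro x hx ζ
    have hm := measurable_transport hB₀ hγ₀ hγ₁ hF x
    refine ((hK ζ).2 (C₃ * (C₂ * N)) (transport B₀ γ (opK B₀ γ g) x) hm.aestronglyMeasurable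
      (Filter.Eventually.of_forall fun q => (hT α _ _ hF x q).2)).1.congr ?_
    filter_upwards [hS x hx] with q hq
    rw [hq.2]
  · intro x hx y hy ζ
    rcases eq_or_ne x y with rfl | hxy
    · simp
    have hd : 0 < ‖x - y‖ := norm_pos_iff.2 (sub_ne_zero.2 hxy)
    rw [hG x hx, hG y hy, ← integral_sub
      (integral_kernelK_mul_transport hB₀ hγ₀ hγ₁ hα₀ hα₁ hF x ζ).1
      (integral_kernelK_mul_transport hB₀ hγ₀ hγ₁ hα₀ hα₁ hF y ζ).1]
    refine (hlog (2 * (C₄ * N * exp (-α * ‖ζ‖ ^ 2))) ‖x - y‖ _ (by positivity) hd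
      (fun s hs => ?_) (fun s hs => ?_)).trans (le_of_eq (by ring))
    · have h1 := (hI N g hg s hs x y ζ).1
      have h2 := (hI N g hg s hs y x ζ).1
      refine (abs_sub _ _).trans ?_
      linarith
    · refine (hI N g hg s hs x y ζ).2.trans ?_
      have : 0 ≤ C₄ * N * exp (-α * ‖ζ‖ ^ 2) * (‖x - y‖ / s) * exp (-κ * s) := by positivity
      linarith
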